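/- Let $m,n$ be integers with $m\ge 0$ and $n\ge 1$ even, and let $p\in[0,1]$. A random matrix $A\in\{0,1\}^{m\times n}$ is from the $(m,n,p)$-Bernoulli ensemble if its entries are independent Bernoulli$(p)$ random variables. Let $W=(W_1,\dots,W_m)$ with $W_i=\sum_{j=1}^n A_{ij}$ be the vector of row weights, and let $Z_0$ be the number of balanced vectors $u\in\{-1,+1\}^n$ (that is, with $\sum_{j=1}^n u_j=0$) such that $Au=0$. Theorem. Fix a constant $C>(2\log 2)^{-1}$, where $\log$ is the natural logarithm. As $n\to\infty$ along even integers, \[ \mathbb E\big[Z_0^2\mid W=w\big]=(1+o(1))\,\mathbb E\big[Z_0\mid W=w\big]^2, \] uniformly over all $m$ with $n\ge C\,m\log m$ (where $0\log 0:=0$), all $p\in[0,1]$, and all vectors $w$ of $m$ even non-negative integers with $w_i<0.49\,n$ for every $i$ and $\mathbb P[W=w]>0$. Explicitly: for every $\varepsilon>0$ there is an $N$, depending only on $C$ and $\varepsilon$, such that for all even $n\ge N$, all $m$ with $n\ge C\,m\log m$, all $p\in[0,1]$, all $A$ from the $(m,n,p)$-Bernoulli ensemble, and all such $w$, \[ \Big|\mathbb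 E\big[Z_0^2\mid W=w\big]-\mathbb E\big[Z_0\mid W=w\big]^2\Big|\le \varepsilon\,\mathbb E\big[Z_0\mid W=w\big]^2 . \] -/

import Mathlib

open MeasureTheory ProbabilityTheory

/-- The random `m × n` matrix `A` on `(Ω, μ)` is from the `(m, n, p)`-Bernoulli ensemble: its
entries are independent random variables, each equal to `1` with probability `p` and to `0` with
probability `1 - p`. -/
structure IsBernoulliEnsemble {Ω : Type*} [MeasurableSpace Ω] (μ : Measure Ω) {m n : ℕ} (p : ℝ)
    (A : Ω → Matrix (Fin m) (Fin n) ℤ) : Prop where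
  measurable_entry : ∀ i j, Measurable fun ω => A ω i j
  indep : iIndepFun (fun (ij : Fin m × Fin n) ω => A ω ij.1 ij.2) μ
  law_entry : ∀ i j, μ.map (fun ω => A ω i j) =
    ENNReal.ofReal p • Measure.dirac 1 + ENNReal.ofReal (1 - p) • Measure.dirac 0

/-- The sign vector `u ∈ {-1, +1}ⁿ` as a vector of integers. -/
def signVec {n : ℕ} (u : Fin n → ℤˣ) : Fin n → ℤ := fun j => (u j : ℤ)

/-- The sign vector `u ∈ {-1, +1}ⁿ` is balanced: its entries sum to zero. -/
def IsBalanced {n : ℕ} (u : Fin n → ℤˣ) : Prop := ∑ j, signVec u j = 0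

open scoped Classical in
/-- The number `Z_r` of balanced sign vectors `u` with `‖A u‖_∞ ≤ r`
(the norm on `Fin m → ℤ` is the maximum norm). -/
noncomputable def balancedCount {m n : ℕ} (r : ℝ) (A : Matrix (Fin m) (Fin n) ℤ) : ℕ :=
  (Finset.univ.filter fun u : Fin n → ℤˣ => IsBalanced u ∧ ‖A.mulVec (signVec u)‖ ≤ r).card

/-- The vector of row weights (row sums) of `A`. -/
def rowWeights {m n : ℕ} (A : Matrix (Fin m) (Fin n) ℤ) : Fin m → ℤ := fun i => ∑ j, A i j

/-- The event `W = w` that the vector of row weights of the random matrix `A` is `w`. -/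
def rowWeightEvent {Ω : Type*} {m n : ℕ} (A : Ω → Matrix (Fin m) (Fin n) ℤ) (w : Fin m → ℕ) :
    Set Ω := {ω | rowWeights (A ω) = fun i => (w i : ℤ)}

/-! Write n = 2h and w_i = 2t_i. Given the row weights, the rows are independent uniform subsets of
sizes 2t_i (`integral_cond_rowWeightEvent`), and Z_0 counts the h-subsets U of the columns that
split every row evenly (`balancedCount_supportMatrix`). Variance is nonnegative, so only an upper
bound on the second moment is needed.

For two such sets with |U ∩ V| = a, the number of rows of size 2t split by both is the sum of
(C(a,s) C(h-a,t-s))^2 over s, which is `hypCollision`. Hence E[Z_0^2]/E[Z_0]^2 is the average, over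
a with weights C(h,a)^2 / C(2h,h), of a product over the rows of `hypCollision` · C(2h,2t) /
C(h,t)^4. The task is to bound this average by 1 + ε.

Central overlaps, δh ≤ a ≤ (1-δ)h: the hypergeometric generating polynomial is real-rooted, so it
factors like that of a sum of t independent Bernoulli variables. Parseval and AM-GM then bound its
collision probability by an explicit integral of (cos² + μ sin²)^t, which expands in the return
probabilities r_k = C(2k,k)/4^k. The leading factors cancel, and each row contributes at most 1 +
K((2a-h)²/h² + 1/h) (`hypCollision_mul_choose_le`). Since (2a-h)²/h has bounded exponential moments
and m/h tends to 0, the product of the rows averages to 1 + o(1) (`sum_choose_sq_mul_exp_le`).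

Outer overlaps: each row contributes at most 2√h, in total (2√h)^m, about exp((m/2) log n). The
condition C > 1/(2 log 2) makes this exponentially smaller than 4^h, while C(h,a)^2 is at most
exp(2ηh) with η as small as needed (`eventually_outer_le`). -/

/-! ### Return probabilities of the simple random walk. -/

/-- The probability `C(2k, k) / 4 ^ k` that a simple random walk returns to `0` at time `2k`. -/
noncomputable def returnProb (k : ℕ) : ℝ := (Nat.centralBinom k : ℝ) / 4 ^ k

lemma returnProb_zero : returnProb 0 = 1 := by simp [returnProb]

lemma returnProb_succ (k : ℕ) :
    returnProb (k + 1) = returnProb k * ((2 * k + 1) / (2 * k + 2)) := by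
  have h : ((k : ℝ) + 1) * (Nat.centralBinom (k + 1) : ℝ) =
      2 * (2 * k + 1) * Nat.centralBinom k := by exact_mod_cast Nat.succ_mul_centralBinom_succ k
  have hk : (k : ℝ) + 1 ≠ 0 := by positivity
  have h' : (Nat.centralBinom (k + 1) : ℝ) = 2 * (2 * k + 1) * Nat.centralBinom k / (k + 1) := by
    field_simp; linarith
  simp only [returnProb]
  rw [h', pow_succ]
  field_simp
  ring

lemma returnProb_pos (k : ℕ) : 0 < returnProb k := by
  have := Nat.centralBinom_pos k
  simp only [returnProb]; positivity

lemma returnProb_antitone : Antitone returnProb := by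
  refine antitone_nat_of_succ_le fun k => ?_
  rw [returnProb_succ]
  refine mul_le_of_le_one_right (returnProb_pos k).le ?_
  rw [div_le_one (by positivity)]; linarith

lemma returnProb_le_one (k : ℕ) : returnProb k ≤ 1 := by
  simpa [returnProb_zero] using returnProb_antitone (Nat.zero_le k)

/-- Together with `antitone_mul_returnProb_sq` this replaces Stirling's formula: ratios of return
probabilities are pinned between explicit square roots, with no error terms. -/
lemma monotone_mul_returnProb_sq : Monotone fun k : ℕ => (k : ℝ) * returnProb k ^ 2 := by
  refine monotone_nat_of_le_succ fun k => ?_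
  rw [returnProb_succ]
  have h : ((k + 1 : ℕ) : ℝ) * (returnProb k * ((2 * k + 1) / (2 * k + 2))) ^ 2 =
      returnProb k ^ 2 * (((2 * k + 1) ^ 2) / (4 * (k + 1))) := by
    push_cast; field_simp; ring
  rw [h, mul_comm]
  refine mul_le_mul_of_nonneg_left ?_ (by positivity)
  rw [le_div_iff₀ (by positivity)]; nlinarith

lemma antitone_mul_returnProb_sq : Antitone fun k : ℕ => (2 * (k : ℝ) + 1) * returnProb k ^ 2 := by
  refine antitone_nat_of_succ_le fun k => ?_
  rw [returnProb_succ]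
  have h : (2 * ((k + 1 : ℕ) : ℝ) + 1) * (returnProb k * ((2 * k + 1) / (2 * k + 2))) ^ 2 =
      returnProb k ^ 2 * ((2 * k + 3) * ((2 * k + 1) ^ 2) / (2 * k + 2) ^ 2) := by
    push_cast; field_simp; ring
  rw [h, mul_comm (2 * (k : ℝ) + 1)]
  refine mul_le_mul_of_nonneg_left ?_ (by positivity)
  rw [div_le_iff₀ (by positivity)]
  nlinarith [show (0 : ℝ) ≤ k from by positivity]

lemma one_le_mul_returnProb {k : ℕ} (hk : 1 ≤ k) : 1 ≤ 2 * Real.sqrt k * returnProb k := by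
  have h := monotone_mul_returnProb_sq hk
  have h1 : returnProb 1 = 1 / 2 := by rw [returnProb_succ, returnProb_zero]; norm_num
  simp only [h1] at h
  rw [← Real.sqrt_one]
  refine Real.sqrt_le_iff.2 ⟨by have := returnProb_pos k; positivity, ?_⟩
  rw [mul_pow, mul_pow, Real.sq_sqrt (by positivity)]
  push_cast at h; linarith

lemma returnProb_le (k : ℕ) : returnProb k * Real.sqrt k ≤ 1 := by
  have h := antitone_mul_returnProb_sq (Nat.zero_le k)
  simp only [returnProb_zero] at h
  refine abs_le_one_iff_mul_self_le_one.2 ?_ |> fun h => (le_abs_self _).trans h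
  have h2 : returnProb k * Real.sqrt k * (returnProb k * Real.sqrt k) = returnProb k ^ 2 * k := by
    rw [mul_mul_mul_comm, Real.mul_self_sqrt (by positivity)]; ring
  rw [h2]
  push_cast at h
  nlinarith [sq_nonneg (returnProb k), show (0 : ℝ) ≤ k from by positivity,
    mul_nonneg (show (0 : ℝ) ≤ k from by positivity) (sq_nonneg (returnProb k))]

/-- Monotonicity of k r_k² gives r_{t-j}² ≤ r_t² · t/(t-j). The bound is stated with j² because it
is exact at j = 0 and is easily summed against μ^j; for integers j, k ≥ 1 one has j/k ≤ 2j²/(k+j).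
-/
lemma returnProb_sub_le {t j : ℕ} (ht : 1 ≤ t) (hj : j ≤ t) :
    returnProb (t - j) ≤ returnProb t * (1 + 2 * (j : ℝ) ^ 2 / t) := by
  have ht0 : (0 : ℝ) < t := by exact_mod_cast ht
  have hpt := returnProb_pos t
  rcases Nat.eq_or_lt_of_le hj with rfl | hlt
  -- At j = t the factor t/(t-j) is infinite; here r_0 = 1 and r_t ≥ 1/(2√t) suffice.
  · rw [Nat.sub_self, returnProb_zero]
    have h := one_le_mul_returnProb ht
    have h2 : 2 * (j : ℝ) ^ 2 / j = 2 * j := by field_simp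
    rw [h2]
    have h3 : 2 * Real.sqrt j ≤ 1 + 2 * j := by
      nlinarith [Real.sq_sqrt ht0.le, sq_nonneg (Real.sqrt j - 1), Real.sqrt_nonneg (j : ℝ)]
    nlinarith
  · obtain ⟨k, rfl⟩ : ∃ k, t = k + j := ⟨t - j, by omega⟩
    have hk : 1 ≤ k := by omega
    have hk0 : (1 : ℝ) ≤ k := by exact_mod_cast hk
    rw [Nat.add_sub_cancel]
    have h := monotone_mul_returnProb_sq (show k ≤ k + j by omega)
    simp only at h
    push_cast at h ⊢
    have hx : (1 : ℝ) + j / k ≤ 1 + 2 * (j : ℝ) ^ 2 / (k + j) := by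
      rcases Nat.eq_zero_or_pos j with rfl | hj0
      · simp
      have hj1 : (1 : ℝ) ≤ j := by exact_mod_cast hj0
      have : (j : ℝ) / k ≤ 2 * (j : ℝ) ^ 2 / (k + j) := by
        rw [div_le_div_iff₀ (by positivity) (by positivity)]
        nlinarith [mul_nonneg (sub_nonneg.2 hj1) (sub_nonneg.2 hk0)]
      linarith
    refine le_trans ?_ (mul_le_mul_of_nonneg_left hx hpt.le)
    refine le_of_sq_le_sq ?_ (by positivity)
    have h3 : returnProb k ^ 2 ≤ returnProb (k + j) ^ 2 * (1 + j / k) := by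
      have : returnProb (k + j) ^ 2 * (1 + (j : ℝ) / k) =
          (k + j) * returnProb (k + j) ^ 2 / k := by field_simp
      rw [this, le_div_iff₀ (by positivity)]; linarith
    refine h3.trans ?_
    rw [mul_pow]
    refine mul_le_mul_of_nonneg_left ?_ (by positivity)
    have : (0 : ℝ) ≤ j / k := by positivity
    nlinarith

lemma returnProb_div_le {h t : ℕ} (ht : t ≤ h) :
    returnProb h / returnProb (h - t) ≤
      Real.sqrt ((2 * ((h : ℝ) - t) + 1) / (2 * h + 1)) := by
  have h1 := antitone_mul_returnProb_sq (Nat.sub_le h t)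
  simp only [Nat.cast_sub ht] at h1
  have hp := returnProb_pos (h - t)
  have hsub : (0 : ℝ) ≤ (h : ℝ) - t := sub_nonneg.2 (by exact_mod_cast ht)
  refine Real.le_sqrt_of_sq_le ?_
  rw [div_pow, div_le_div_iff₀ (by positivity) (by positivity)]
  linarith

lemma returnProb_mul_div {n k : ℕ} (hk : k ≤ n) :
    returnProb k * returnProb (n - k) / returnProb n =
      (Nat.choose n k : ℝ) ^ 2 / (Nat.choose (2 * n) (2 * k) : ℝ) := by
  have e1 : (4 : ℝ) ^ k * 4 ^ (n - k) = 4 ^ n := by rw [← pow_add]; congr 1; omega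
  have c1 : (Nat.choose n k : ℝ) = (n.factorial : ℝ) / (k.factorial * (n - k).factorial) :=
    Nat.cast_choose ℝ hk
  have c2 : (Nat.choose (2 * n) (2 * k) : ℝ) =
      ((2 * n).factorial : ℝ) / ((2 * k).factorial * (2 * (n - k)).factorial) := by
    rw [Nat.cast_choose ℝ (by omega), show 2 * n - 2 * k = 2 * (n - k) by omega]
  have c3 : ∀ i : ℕ, (Nat.centralBinom i : ℝ) =
      ((2 * i).factorial : ℝ) / (i.factorial * i.factorial) := by
    intro i
    rw [Nat.centralBinom, Nat.cast_choose ℝ (by omega), show 2 * i - i = i by omega]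
  have f0 : ∀ i : ℕ, (i.factorial : ℝ) ≠ 0 := fun i => by exact_mod_cast i.factorial_ne_zero
  simp only [returnProb]
  rw [c1, c2, c3, c3, c3, ← e1]
  have := f0 n; have := f0 k; have := f0 (n-k); have := f0 (2*n); have := f0 (2*k)
  have := f0 (2*(n-k))
  field_simp

/-! ### Wallis-type integrals and convolutions of return probabilities. -/

/-- Integration by parts: sin^(2j+1) cos^(2k+1) vanishes at 0 and π, so its derivative integrates to
zero. -/
lemma integral_sin_cos_rec (j k : ℕ) :
    (2 * (j : ℝ) + 1) * ∫ x in (0 : ℝ)..Real.pi, Real.sin x ^ (2 * j) * Real.cos x ^ (2 * (k + 1)) =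
      (2 * (k : ℝ) + 1) *
        ∫ x in (0 : ℝ)..Real.pi, Real.sin x ^ (2 * (j + 1)) * Real.cos x ^ (2 * k) := by
  have hd : ∀ x ∈ Set.uIcc (0 : ℝ) Real.pi,
      HasDerivAt (fun x => Real.sin x ^ (2 * j + 1) * Real.cos x ^ (2 * k + 1))
        ((2 * (j : ℝ) + 1) * (Real.sin x ^ (2 * j) * Real.cos x ^ (2 * (k + 1))) -
          (2 * (k : ℝ) + 1) * (Real.sin x ^ (2 * (j + 1)) * Real.cos x ^ (2 * k))) x := by
    intro x _
    refine (((Real.hasDerivAt_sin x).pow (2 * j + 1)).mul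
      ((Real.hasDerivAt_cos x).pow (2 * k + 1))).congr_deriv ?_
    simp only [Pi.pow_apply, Nat.add_sub_cancel]
    push_cast
    ring
  have h := intervalIntegral.integral_eq_sub_of_hasDerivAt hd
    (Continuous.intervalIntegrable (by fun_prop) _ _)
  rw [intervalIntegral.integral_sub (Continuous.intervalIntegrable (by fun_prop) _ _)
    (Continuous.intervalIntegrable (by fun_prop) _ _),
    intervalIntegral.integral_const_mul, intervalIntegral.integral_const_mul] at h
  simp at h
  simp only [mul_add, mul_one] at h ⊢
  linarith

lemma integral_sin_cos_add (j k : ℕ) :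
    (∫ x in (0 : ℝ)..Real.pi, Real.sin x ^ (2 * (j + 1)) * Real.cos x ^ (2 * k)) +
      (∫ x in (0 : ℝ)..Real.pi, Real.sin x ^ (2 * j) * Real.cos x ^ (2 * (k + 1))) =
        ∫ x in (0 : ℝ)..Real.pi, Real.sin x ^ (2 * j) * Real.cos x ^ (2 * k) := by
  rw [← intervalIntegral.integral_add (Continuous.intervalIntegrable (by fun_prop) _ _)
    (Continuous.intervalIntegrable (by fun_prop) _ _)]
  congr 1; ext x
  have h := Real.sin_sq_add_cos_sq x
  have : Real.sin x ^ (2 * (j + 1)) * Real.cos x ^ (2 * k) +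
      Real.sin x ^ (2 * j) * Real.cos x ^ (2 * (k + 1)) =
      Real.sin x ^ (2 * j) * Real.cos x ^ (2 * k) * (Real.sin x ^ 2 + Real.cos x ^ 2) := by ring
  rw [this, h, mul_one]

lemma choose_add_succ_left (j k : ℕ) :
    ((j : ℝ) + 1) * ((j + 1 + k).choose (j + 1) : ℝ) = (j + k + 1) * ((j + k).choose j : ℝ) := by
  have h := Nat.add_one_mul_choose_eq (j + k) j
  rw [show j + 1 + k = j + k + 1 by ring]
  have : (((j + k + 1) * (j + k).choose j : ℕ) : ℝ) =
    (((j + k + 1).choose (j + 1) * (j + 1) : ℕ) : ℝ) := by exact_mod_cast h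
  push_cast at this; linarith

/-- The recursion and sin² + cos² = 1 multiply the integral by (2j+1)/(2(j+k+1)) when j increases by
one. The binomial factor gains (j+k+1)/(j+1), which leaves exactly r_{j+1}/r_j. -/
lemma integral_sin_cos_mul_choose (j k : ℕ) :
    ((j + k).choose j : ℝ) *
      (∫ x in (0 : ℝ)..Real.pi, Real.sin x ^ (2 * j) * Real.cos x ^ (2 * k)) =
        Real.pi * (returnProb j * returnProb k) := by
  induction j with
  | zero =>
    induction k with
    | zero => simp [returnProb_zero]
    | succ k ih =>
      have h1 := integral_sin_cos_rec 0 k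
      have h2 := integral_sin_cos_add 0 k
      rw [returnProb_succ]
      simp only [Nat.choose_zero_right, Nat.cast_one, one_mul, Nat.cast_zero, mul_zero,
        zero_add] at *
      rw [← h2] at ih
      have h3 : (∫ x in (0 : ℝ)..Real.pi, Real.sin x ^ 0 * Real.cos x ^ (2 * (k + 1))) *
          (2 * k + 2) = (2 * k + 1) * (Real.pi * (returnProb 0 * returnProb k)) := by
        rw [← ih]; linear_combination h1
      simp only [pow_zero, one_mul] at h3
      field_simp
      linarith
  | succ j ih =>
    have h1 := integral_sin_cos_rec j k
    have h2 := integral_sin_cos_add j k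
    rw [← h2] at ih
    rw [returnProb_succ]
    have h3 := choose_add_succ_left j k
    have hj : (j : ℝ) + 1 ≠ 0 := by positivity
    have h4 : ((j + 1 + k).choose (j + 1) : ℝ) = (j + k + 1) * ((j + k).choose j : ℝ) / (j + 1) := by
      field_simp; linarith
    rw [h4]
    field_simp
    have : Real.pi * returnProb j * (j * 2 + 1) * returnProb k =
      (2 * j + 1) * (Real.pi * (returnProb j * returnProb k)) := by ring
    rw [this, ← ih]
    linear_combination (-((j + k).choose j : ℝ)) * h1

lemma integral_cos_sq_add_mul_sin_sq_pow (t : ℕ) (μ : ℝ) :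
    (∫ x in (0 : ℝ)..Real.pi, (Real.cos x ^ 2 + μ * Real.sin x ^ 2) ^ t) =
      Real.pi * ∑ j ∈ Finset.range (t + 1), returnProb j * returnProb (t - j) * μ ^ j := by
  have h : ∀ x : ℝ, (Real.cos x ^ 2 + μ * Real.sin x ^ 2) ^ t =
      ∑ j ∈ Finset.range (t + 1),
        μ ^ j * (t.choose j : ℝ) * (Real.sin x ^ (2 * j) * Real.cos x ^ (2 * (t - j))) := by
    intro x
    rw [add_comm, add_pow]
    refine Finset.sum_congr rfl fun j _ => ?_
    rw [mul_pow, ← pow_mul, ← pow_mul]; ring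
  simp_rw [h]
  rw [intervalIntegral.integral_finsetSum
    fun j _ => Continuous.intervalIntegrable (by fun_prop) _ _, Finset.mul_sum]
  refine Finset.sum_congr rfl fun j hj => ?_
  have hj' : j ≤ t := Nat.lt_succ_iff.1 (Finset.mem_range.1 hj)
  have h2 := integral_sin_cos_mul_choose j (t - j)
  rw [Nat.add_sub_cancel' hj'] at h2
  rw [intervalIntegral.integral_const_mul, mul_assoc, h2]; ring

lemma sum_returnProb_mul (t : ℕ) :
    ∑ j ∈ Finset.range (t + 1), returnProb j * returnProb (t - j) = 1 := by
  have h := integral_cos_sq_add_mul_sin_sq_pow t 1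
  simp only [one_mul, Real.cos_sq_add_sin_sq, one_pow, mul_one] at h
  simpa using h

/-- The generating function of r_j is (1-μ)^(-1/2): by `sum_returnProb_mul` its Cauchy square is the
geometric series. -/
lemma sum_returnProb_mul_pow_le {μ : ℝ} (h0 : 0 ≤ μ) (h1 : μ < 1) (t : ℕ) :
    ∑ j ∈ Finset.range t, returnProb j * μ ^ j ≤ 1 / Real.sqrt (1 - μ) := by
  have hnn : ∀ j, 0 ≤ returnProb j * μ ^ j := fun j =>
    mul_nonneg (returnProb_pos j).le (pow_nonneg h0 j)
  have hs : Summable fun j => returnProb j * μ ^ j :=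
    Summable.of_nonneg_of_le hnn
      (fun j => mul_le_of_le_one_left (pow_nonneg h0 j) (returnProb_le_one j))
      (summable_geometric_of_lt_one h0 h1)
  refine (hs.sum_le_tsum _ fun j _ => hnn j).trans (le_of_eq ?_)
  have hsq : (∑' j, returnProb j * μ ^ j) * (∑' j, returnProb j * μ ^ j) = (1 - μ)⁻¹ := by
    rw [tsum_mul_tsum_eq_tsum_sum_antidiagonal_of_summable_norm hs.norm hs.norm,
      ← tsum_geometric_of_lt_one h0 h1]
    congr 1; ext k
    rw [Finset.Nat.sum_antidiagonal_eq_sum_range_succ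
      (fun i j => returnProb i * μ ^ i * (returnProb j * μ ^ j))]
    rw [← one_mul (μ ^ k), ← sum_returnProb_mul k, Finset.sum_mul]
    refine Finset.sum_congr rfl fun j hj => ?_
    have hj' : j ≤ k := Nat.lt_succ_iff.1 (Finset.mem_range.1 hj)
    rw [← Nat.add_sub_cancel' hj', pow_add, Nat.add_sub_cancel' hj']; ring
  rw [one_div, ← Real.sqrt_inv, ← hsq, Real.sqrt_mul_self (tsum_nonneg hnn)]

lemma sum_sq_mul_pow_le {μ : ℝ} (h0 : 0 ≤ μ) (h1 : μ < 1) (t : ℕ) :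
    ∑ j ∈ Finset.range t, (j : ℝ) ^ 2 * μ ^ j ≤ 2 * μ / (1 - μ) ^ 3 := by
  have hn : ‖μ‖ < 1 := by rwa [Real.norm_of_nonneg h0]
  have hs := summable_choose_mul_geometric_of_norm_lt_one 2 hn
  have ht := tsum_choose_mul_geometric_of_norm_lt_one 2 hn
  rcases t with _ | t
  · have : 0 < 1 - μ := by linarith
    simp; positivity
  rw [Finset.sum_range_succ']
  simp only [Nat.cast_zero, ne_eq, OfNat.ofNat_ne_zero, not_false_eq_true, zero_pow, zero_mul,
    add_zero]
  have h2 : ∀ j : ℕ, ((j + 1 : ℕ) : ℝ) ^ 2 * μ ^ (j + 1) ≤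
      2 * μ * (((j + 2).choose 2 : ℝ) * μ ^ j) := by
    intro j
    have : ((j + 2).choose 2 : ℝ) = (j + 2) * (j + 1) / 2 := by
      rw [Nat.cast_choose_two]; push_cast; ring
    rw [this, pow_succ μ j]
    have hm : 0 ≤ μ ^ j * μ := by positivity
    push_cast
    nlinarith [mul_nonneg (show (0:ℝ) ≤ j by positivity) hm]
  calc _ ≤ ∑ j ∈ Finset.range t, 2 * μ * (((j + 2).choose 2 : ℝ) * μ ^ j) :=
        Finset.sum_le_sum fun j _ => h2 j
    _ = 2 * μ * ∑ j ∈ Finset.range t, (((j + 2).choose 2 : ℝ) * μ ^ j) := by rw [Finset.mul_sum]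
    _ ≤ 2 * μ * (1 / (1 - μ) ^ (2 + 1)) := by
        rw [← ht]
        exact mul_le_mul_of_nonneg_left (hs.sum_le_tsum _ fun j _ => by positivity) (by positivity)
    _ = _ := by ring

/-- For μ away from 1 the sum is dominated by small j, where r_{t-j} is close to r_t. The main term
is the full generating function, and the correction 2j²/t from `returnProb_sub_le` gives the term of
order μ/t. -/
lemma sum_returnProb_mul_returnProb_mul_pow_le {μ : ℝ} (h0 : 0 ≤ μ) (h1 : μ < 1) {t : ℕ}
    (ht : 1 ≤ t) :
    ∑ j ∈ Finset.range (t + 1), returnProb j * returnProb (t - j) * μ ^ j ≤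
      returnProb t * (1 / Real.sqrt (1 - μ) + 4 * μ / (t * (1 - μ) ^ 3)) := by
  have hpt := returnProb_pos t
  have ht0 : (0 : ℝ) < t := by exact_mod_cast ht
  have hb : ∀ j ∈ Finset.range (t + 1), returnProb j * returnProb (t - j) * μ ^ j ≤
      returnProb t * (returnProb j * μ ^ j + 2 / t * ((j : ℝ) ^ 2 * μ ^ j)) := by
    intro j hj
    have hj' : j ≤ t := Nat.lt_succ_iff.1 (Finset.mem_range.1 hj)
    have hμ : 0 ≤ μ ^ j := pow_nonneg h0 j
    have hpj := returnProb_pos j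
    calc returnProb j * returnProb (t - j) * μ ^ j
        ≤ returnProb j * (returnProb t * (1 + 2 * (j : ℝ) ^ 2 / t)) * μ ^ j := by
          gcongr; exact returnProb_sub_le ht hj'
      _ = returnProb t * (returnProb j * μ ^ j +
            returnProb j * (2 / t * ((j : ℝ) ^ 2 * μ ^ j))) := by ring
      _ ≤ _ := by
          refine mul_le_mul_of_nonneg_left (add_le_add_right ?_ _) hpt.le
          exact mul_le_of_le_one_left (by positivity) (returnProb_le_one j)
  refine (Finset.sum_le_sum hb).trans ?_
  rw [← Finset.mul_sum, Finset.sum_add_distrib, ← Finset.mul_sum]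
  gcongr
  · exact sum_returnProb_mul_pow_le h0 h1 _
  · calc _ ≤ 2 / (t : ℝ) * (2 * μ / (1 - μ) ^ 3) := by
          gcongr; exact sum_sq_mul_pow_le h0 h1 _
      _ = _ := by have : 1 - μ ≠ 0 := by linarith
                  field_simp; ring

/-! ### Real-rootedness of the hypergeometric generating polynomial. -/

/-- Rolle: passing to the derivative loses at most one real root, counted with multiplicity. -/
lemma Polynomial.Splits.derivative_real {p : Polynomial ℝ} (hp : p.Splits) :
    (Polynomial.derivative p).Splits := by
  rw [Polynomial.splits_iff_card_roots] at hp ⊢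
  have h1 := Polynomial.card_roots_le_derivative p
  have h2 := Polynomial.card_roots' (Polynomial.derivative p)
  have h3 := Polynomial.natDegree_derivative_le p
  omega

lemma Polynomial.Splits.iterate_derivative_real {p : Polynomial ℝ} (hp : p.Splits) (k : ℕ) :
    (Polynomial.derivative^[k] p).Splits := by
  induction k with
  | zero => exact hp
  | succ k ih => rw [Function.iterate_succ_apply']; exact ih.derivative_real

lemma Polynomial.Splits.hasseDeriv_real {p : Polynomial ℝ} (hp : p.Splits) (k : ℕ) :
    (Polynomial.hasseDeriv k p).Splits := by
  have h := congrFun (Polynomial.factorial_smul_hasseDeriv (R := ℝ) k) p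
  have h2 : Polynomial.hasseDeriv k p =
      Polynomial.C ((k.factorial : ℝ)⁻¹) * Polynomial.derivative^[k] p := by
    rw [← h]
    have : (k.factorial : ℝ) ≠ 0 := by exact_mod_cast k.factorial_ne_zero
    rw [← Polynomial.smul_eq_C_mul, LinearMap.smul_apply, ← Nat.cast_smul_eq_nsmul ℝ, smul_smul,
      inv_mul_cancel₀ this, one_smul]
  rw [h2]
  exact (hp.iterate_derivative_real k).C_mul _

-- The left side is, up to the reversal y = -1/w, the Hasse derivative of order a+b-t of (X-1)^a
-- X^b. That polynomial is real-rooted, hence so is its derivative, and the c_i are the roots of the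
-- derivative.
open Polynomial in
lemma exists_real_factorization (a b t : ℕ) (ht : t ≤ a + b) :
    ∃ c : Fin t → ℝ,
      (∑ k ∈ Finset.range (t + 1), C ((a.choose k : ℝ) * ((a + b - k).choose (t - k) : ℝ)) * X ^ k) =
        C ((a + b).choose t : ℝ) * ∏ i, (1 + C (c i) * X) := by
  set P : ℝ[X] := (X - 1) ^ a * X ^ b with hP
  have hPm : P.Monic := ((monic_X_sub_C (1 : ℝ)).pow a).mul (monic_X.pow b)
  have hPd : P.natDegree = a + b := by
    have h1 : (X - 1 : ℝ[X]) = X - C 1 := by simp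
    rw [hP, h1, Monic.natDegree_mul ((monic_X_sub_C (1 : ℝ)).pow a) (monic_X.pow b),
      (monic_X_sub_C (1 : ℝ)).natDegree_pow, natDegree_X_sub_C, natDegree_X_pow, mul_one]
  have hPs : P.Splits := by
    have h1 : (X - 1 : ℝ[X]) = X - C 1 := by simp
    rw [hP, h1]
    exact ((Splits.X_sub_C 1).pow a).mul (Splits.X.pow b)
  set D := hasseDeriv (a + b - t) P with hD
  have hDs : D.Splits := hPs.hasseDeriv_real _
  have hDc : D.coeff t = ((a + b).choose t : ℝ) := by
    rw [hD, hasseDeriv_coeff, show t + (a + b - t) = a + b by omega]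
    have : P.coeff (a + b) = 1 := by rw [← hPd]; exact hPm
    rw [this, mul_one, Nat.choose_symm ht]
  have hDd : D.natDegree = t := by
    rw [hD, natDegree_hasseDeriv, hPd]; omega
  have hDl : D.leadingCoeff = ((a + b).choose t : ℝ) := by rw [leadingCoeff, hDd, hDc]
  have hPsum : P = ∑ k ∈ Finset.range (a + 1), monomial (a + b - k) ((-1 : ℝ) ^ k * a.choose k) := by
    rw [hP, sub_eq_add_neg, add_comm, add_pow, Finset.sum_mul]
    refine Finset.sum_congr rfl fun k hk => ?_
    have hk' : k ≤ a := Nat.lt_succ_iff.1 (Finset.mem_range.1 hk)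
    rw [← C_mul_X_pow_eq_monomial, show a + b - k = (a - k) + b by omega, pow_add]
    simp only [map_mul, map_pow, map_neg, map_one, map_natCast]
    ring
  have hDe : ∀ y : ℝ, D.eval y = ∑ k ∈ Finset.range (t + 1),
      (-1 : ℝ) ^ k * (a.choose k * (a + b - k).choose (t - k)) * y ^ (t - k) := by
    intro y
    have e1 : D.eval y = ∑ k ∈ Finset.range (a + 1),
        (-1 : ℝ) ^ k * (a.choose k * (a + b - k).choose (a + b - t)) * y ^ (t - k) := by
      rw [hD, hPsum, map_sum, eval_finsetSum]
      refine Finset.sum_congr rfl fun k hk => ?_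
      rw [hasseDeriv_monomial, eval_monomial, show a + b - k - (a + b - t) = t - k by omega]
      ring
    -- Padding the range is free: terms with k > a vanish through C(a,k), and those with k > t
    -- through C(a+b-k, a+b-t).
    have e2 : D.eval y = ∑ k ∈ Finset.range (a + b + 1),
        (-1 : ℝ) ^ k * (a.choose k * (a + b - k).choose (a + b - t)) * y ^ (t - k) := by
      rw [e1]
      refine Finset.sum_subset (Finset.range_mono (by omega)) fun k _ hk => ?_
      rw [Nat.choose_eq_zero_of_lt (by simpa using hk)]; simp
    rw [e2]
    refine (Finset.sum_subset (Finset.range_mono (show t + 1 ≤ a + b + 1 by omega))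
      fun k hk hk' => ?_).symm.trans ?_
    · rw [Finset.mem_range] at hk hk'
      rw [Nat.choose_eq_zero_of_lt (show a + b - k < a + b - t by omega)]; simp
    · refine Finset.sum_congr rfl fun k hk => ?_
      rw [Finset.mem_range] at hk
      rw [Nat.choose_symm_of_eq_add (show a + b - k = (a + b - t) + (t - k) by omega)]
  obtain ⟨l, hl⟩ := Quot.exists_rep D.roots
  have hl' : D.roots = (l : Multiset ℝ) := hl.symm
  have hlen : l.length = t := by
    have := splits_iff_card_roots.1 hDs
    rw [hl', hDd] at this; simpa using this
  subst hlen
  refine ⟨fun i => l.get i, ?_⟩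
  have hDp : ∀ y : ℝ, D.eval y = ((a + b).choose l.length : ℝ) * ∏ i, (y - l.get i) := by
    intro y
    rw [hDs.eval_eq_prod_roots, hDl, hl', Multiset.map_coe, Multiset.prod_coe]
    congr 1
    exact (Fin.prod_univ_fun_getElem l (fun x => y - x)).symm
  refine Polynomial.funext fun w => ?_
  simp only [eval_finsetSum, eval_mul, eval_C, eval_pow, eval_X, eval_prod, eval_add, eval_one]
  by_cases hw : w = 0
  · subst hw
    rw [Finset.sum_eq_single 0]
    · simp
    · intro k _ hk; simp [hk]
    · simp
  have key := hDp (-w⁻¹)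
  rw [hDe] at key
  have key2 := congrArg (fun x => (-w) ^ l.length * x) key
  simp only [Finset.mul_sum] at key2
  have r1 : ∏ i : Fin l.length, (1 + l.get i * w) =
      (-w) ^ l.length * ∏ i : Fin l.length, (-w⁻¹ - l.get i) := by
    have : (-w) ^ l.length = ∏ _i : Fin l.length, (-w) := by simp
    rw [this, ← Finset.prod_mul_distrib]
    refine Finset.prod_congr rfl fun i _ => ?_
    field_simp; ring
  rw [r1, mul_left_comm, ← key2]
  refine Finset.sum_congr rfl fun k hk => ?_
  have hk' : k ≤ l.length := Nat.lt_succ_iff.1 (Finset.mem_range.1 hk)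
  have : (-w) ^ l.length = (-w) ^ k * (-w) ^ (l.length - k) := by
    rw [← pow_add]; congr 1; omega
  rw [this]
  have h2 : (-w) ^ (l.length - k) * (-w⁻¹) ^ (l.length - k) = 1 := by
    rw [← mul_pow]
    have : -w * -w⁻¹ = 1 := by field_simp
    rw [this, one_pow]
  have h3 : (-w) ^ k * (-1) ^ k = w ^ k := by rw [← mul_pow]; simp
  calc _ = (a.choose k * (a + b - k).choose (l.length - k) : ℝ) * ((-w) ^ k * (-1) ^ k) *
        ((-w) ^ (l.length - k) * (-w⁻¹) ^ (l.length - k)) := by rw [h2, h3, mul_one]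
    _ = _ := by ring

open Polynomial in
lemma coeff_prod_one_add {ι : Type*} (s : Finset ι) (c : ι → ℝ) :
    (∏ i ∈ s, (1 + C (c i) * X)).coeff 0 = 1 ∧
    (∏ i ∈ s, (1 + C (c i) * X)).coeff 1 = ∑ i ∈ s, c i ∧
    2 * (∏ i ∈ s, (1 + C (c i) * X)).coeff 2 = (∑ i ∈ s, c i) ^ 2 - ∑ i ∈ s, c i ^ 2 := by
  classical
  induction s using Finset.induction_on with
  | empty => simp [coeff_one]
  | insert i s hi ih =>
    obtain ⟨h0, h1, h2⟩ := ih
    rw [Finset.prod_insert hi, Finset.sum_insert hi, Finset.sum_insert hi]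
    have e : ∀ Q : ℝ[X], (1 + C (c i) * X) * Q = Q + C (c i) * (Q * X) := fun Q => by ring
    rw [e]
    refine ⟨?_, ?_, ?_⟩
    · simp [h0]
    · rw [coeff_add, coeff_C_mul, show 1 = 0 + 1 from rfl, coeff_mul_X, h0, zero_add, h1]; ring
    · rw [coeff_add, coeff_C_mul, show 2 = 1 + 1 from rfl, coeff_mul_X, h1]
      linear_combination h2

-- Both sides are the coefficient of X^t in (1+zX)^a (1+X)^b; the right side comes from writing 1+zX
-- = (z-1)X + (1+X).
open Polynomial in
lemma sum_choose_mul_choose_mul_pow (a b t : ℕ) (z : ℂ) :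
    ∑ s ∈ Finset.range (t + 1), (a.choose s : ℂ) * (b.choose (t - s) : ℂ) * z ^ s =
      ∑ k ∈ Finset.range (t + 1),
        (a.choose k : ℂ) * ((a + b - k).choose (t - k) : ℂ) * (z - 1) ^ k := by
  have h1 : ((1 + C z * X) ^ a * (1 + X) ^ b : ℂ[X]).coeff t =
      ∑ s ∈ Finset.range (t + 1), (a.choose s : ℂ) * (b.choose (t - s) : ℂ) * z ^ s := by
    rw [coeff_mul, Finset.Nat.sum_antidiagonal_eq_sum_range_succ_mk]
    refine Finset.sum_congr rfl fun s _ => ?_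
    have : (1 + C z * X : ℂ[X]) ^ a = ((1 + X) ^ a).comp (C z * X) := by simp
    rw [this, comp_C_mul_X_coeff, coeff_one_add_X_pow, coeff_one_add_X_pow]
    ring
  have h2 : ((1 + C z * X) ^ a * (1 + X) ^ b : ℂ[X]) =
      ∑ k ∈ Finset.range (a + 1),
        C ((a.choose k : ℂ) * (z - 1) ^ k) * ((1 + X) ^ (a + b - k) * X ^ k) := by
    have : (1 + C z * X : ℂ[X]) = C (z - 1) * X + (1 + X) := by simp; ring
    rw [this, add_pow, Finset.sum_mul]
    refine Finset.sum_congr rfl fun k hk => ?_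
    have hk' : k ≤ a := Nat.lt_succ_iff.1 (Finset.mem_range.1 hk)
    rw [show a + b - k = (a - k) + b by omega, pow_add]
    simp only [map_mul, map_pow, map_natCast]
    ring
  rw [← h1, h2, finsetSum_coeff]
  have h3 : ∀ k, (C ((a.choose k : ℂ) * (z - 1) ^ k) * ((1 + X) ^ (a + b - k) * X ^ k)).coeff t =
      if k ≤ t then (a.choose k : ℂ) * ((a + b - k).choose (t - k) : ℂ) * (z - 1) ^ k else 0 := by
    intro k
    rw [coeff_C_mul, coeff_mul_X_pow']
    split_ifs
    · rw [coeff_one_add_X_pow]; ring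
    · simp
  simp_rw [h3]
  trans ∑ k ∈ Finset.range (a + t + 1), if k ≤ t then
    (a.choose k : ℂ) * ((a + b - k).choose (t - k) : ℂ) * (z - 1) ^ k else 0
  · refine Finset.sum_subset (Finset.range_mono (by omega)) fun k _ hk => ?_
    rw [Nat.choose_eq_zero_of_lt (by simpa using hk)]; simp
  · refine (Finset.sum_subset (Finset.range_mono (show t + 1 ≤ a + t + 1 by omega))
      fun k _ hk => ?_).symm.trans ?_
    · rw [Finset.mem_range] at hk; rw [if_neg (by omega)]
    · refine Finset.sum_congr rfl fun k hk => ?_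
      rw [Finset.mem_range] at hk; rw [if_pos (by omega)]

lemma cast_choose_pred_mul {h t : ℕ} (hh : 1 ≤ h) (ht : 1 ≤ t) :
    ((h - 1).choose (t - 1) : ℝ) * h = h.choose t * t := by
  obtain ⟨h, rfl⟩ := Nat.exists_eq_add_of_le' hh
  obtain ⟨t, rfl⟩ := Nat.exists_eq_add_of_le' ht
  have := Nat.add_one_mul_choose_eq h t
  simp only [Nat.add_sub_cancel]
  rw [mul_comm]; exact_mod_cast this

/-- The probability generating function of a hypergeometric distribution is that of a sum of
independent Bernoulli variables. -/
lemma exists_bernoulli_factorization {a b t : ℕ} (ht1 : 1 ≤ t) (ht : t ≤ a + b) (h2 : 2 ≤ a + b) :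
    ∃ c : Fin t → ℝ,
      (∀ z : ℂ, ∑ s ∈ Finset.range (t + 1), (a.choose s : ℂ) * (b.choose (t - s) : ℂ) * z ^ s =
        ((a + b).choose t : ℂ) * ∏ i, (1 + (c i : ℂ) * (z - 1))) ∧
      ∑ i, c i * (1 - c i) =
        t * ((a : ℝ) * b * (a + b - t) / ((a + b) ^ 2 * (a + b - 1))) := by
  obtain ⟨c, hc⟩ := exists_real_factorization a b t ht
  refine ⟨c, fun z => ?_, ?_⟩
  · rw [sum_choose_mul_choose_mul_pow]
    have := congrArg (Polynomial.aeval (z - 1)) hc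
    simpa [map_sum, map_prod] using this
  · obtain ⟨-, e1, e2⟩ := coeff_prod_one_add Finset.univ c
    have hcoeff : ∀ j, (∑ k ∈ Finset.range (t + 1), Polynomial.C
        ((a.choose k : ℝ) * ((a + b - k).choose (t - k) : ℝ)) * Polynomial.X ^ k).coeff j =
        if j ≤ t then (a.choose j : ℝ) * ((a + b - j).choose (t - j) : ℝ) else 0 := by
      intro j
      simp only [Polynomial.finsetSum_coeff, Polynomial.coeff_C_mul, Polynomial.coeff_X_pow]
      simp
    have f1 := hcoeff 1
    have f2 := hcoeff 2
    rw [hc, Polynomial.coeff_C_mul] at f1 f2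
    rw [e1, if_pos ht1, Nat.choose_one_right] at f1
    have hN : (0 : ℝ) < ((a + b).choose t : ℝ) := by exact_mod_cast Nat.choose_pos ht
    have hh : (2 : ℝ) ≤ (a : ℝ) + b := by exact_mod_cast h2
    have hh0 : (a : ℝ) + b ≠ 0 := by linarith
    have hh1 : (a : ℝ) + b - 1 ≠ 0 := by linarith
    have g1 := cast_choose_pred_mul (h := a + b) (t := t) (by omega) ht1
    push_cast at g1
    have s1 : ∑ i, c i = a * t / (a + b) := by
      have : ((a + b).choose t : ℝ) * ((∑ i, c i) * (a + b)) =
        ((a + b).choose t : ℝ) * (a * t) := by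
        rw [← mul_assoc, f1, mul_assoc, g1]; ring
      rw [eq_div_iff hh0]; exact mul_left_cancel₀ hN.ne' this
    have s2 : (∑ i, c i) ^ 2 - ∑ i, c i ^ 2 =
        a * (a - 1) * (t * (t - 1)) / ((a + b) * (a + b - 1)) := by
      rw [← e2]
      rw [eq_div_iff (mul_ne_zero hh0 hh1)]
      refine mul_left_cancel₀ hN.ne' ?_
      -- For t = 1 there is no quadratic coefficient, and t(t-1) = 0 agrees with this.
      rcases Nat.lt_or_ge t 2 with h | h
      · have : t = 1 := by omega
        subst this
        rw [if_neg (by omega)] at f2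
        have : (∏ i, (1 + Polynomial.C (c i) * Polynomial.X)).coeff 2 = 0 :=
          (mul_eq_zero.1 f2).resolve_left hN.ne'
        rw [this]; simp
      · rw [if_pos h] at f2
        have g2 := cast_choose_pred_mul (h := a + b - 1) (t := t - 1) (by omega) (by omega)
        rw [Nat.sub_sub, Nat.sub_sub, Nat.cast_sub (by omega), Nat.cast_sub (by omega)] at g2
        push_cast at g2
        rw [Nat.cast_choose_two] at f2
        have : ((a + b).choose t : ℝ) * (a * (a - 1) * (t * (t - 1))) =
          a * (a - 1) * (t - 1) * (((a + b).choose t : ℝ) * t) := by ring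
        rw [this, ← g1]
        have : (a : ℝ) * (a - 1) * (t - 1) * (((a + b - 1).choose (t - 1) : ℝ) * (a + b)) =
          a * (a - 1) * (a + b) * (((a + b - 1).choose (t - 1) : ℝ) * (t - 1)) := by ring
        rw [this, ← g2]
        linear_combination (2 * ((a : ℝ) + b) * (a + b - 1)) * f2
    have : ∑ i, c i * (1 - c i) = ∑ i, c i - ∑ i, c i ^ 2 := by
      rw [← Finset.sum_sub_distrib]; exact Finset.sum_congr rfl fun i _ => by ring
    have s3 : ∑ i, c i ^ 2 = (∑ i, c i) ^ 2 -
      a * (a - 1) * (t * (t - 1)) / ((a + b) * (a + b - 1)) := by linarith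
    rw [this, s3, s1]
    field_simp
    ring

/-! ### Fourier bound for the hypergeometric collision probability. -/

lemma integral_cos_two_mul_int (k : ℤ) :
    (∫ x in (0 : ℝ)..Real.pi, Real.cos (2 * k * x)) = if k = 0 then Real.pi else 0 := by
  split_ifs with h
  · simp [h]
  · have hk : (2 * (k : ℝ)) ≠ 0 := by simpa using h
    rw [intervalIntegral.integral_comp_mul_left (fun x => Real.cos x) hk, integral_cos]
    have : Real.sin (2 * k * Real.pi) = 0 := by
      have := Real.sin_int_mul_pi (2 * k)
      push_cast at this; exact this
    simp [this]

/-- Parseval's identity for a trigonometric polynomial with real coefficients. -/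
lemma integral_normSq_sum_exp (t : ℕ) (p : ℕ → ℝ) :
    (∫ x in (0 : ℝ)..Real.pi, Complex.normSq (∑ s ∈ Finset.range t,
      (p s : ℂ) * Complex.exp ((2 * x : ℝ) * Complex.I) ^ s)) =
      Real.pi * ∑ s ∈ Finset.range t, p s ^ 2 := by
  have h : ∀ x : ℝ, Complex.normSq (∑ s ∈ Finset.range t,
      (p s : ℂ) * Complex.exp ((2 * x : ℝ) * Complex.I) ^ s) =
      ∑ s ∈ Finset.range t, ∑ r ∈ Finset.range t,
        p s * p r * Real.cos (2 * (((s : ℤ) - r : ℤ) : ℝ) * x) := by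
    intro x
    have e : ∀ s : ℕ, (p s : ℂ) * Complex.exp ((2 * x : ℝ) * Complex.I) ^ s =
        ((p s * Real.cos (2 * s * x) : ℝ) : ℂ) + ((p s * Real.sin (2 * s * x) : ℝ) : ℂ) *
          Complex.I := by
      intro s
      rw [← Complex.exp_nat_mul,
        show (s : ℂ) * ((2 * x : ℝ) * Complex.I) = ((2 * s * x : ℝ) : ℂ) * Complex.I by
          push_cast; ring, Complex.exp_mul_I]
      push_cast; ring
    simp_rw [e]
    rw [Finset.sum_add_distrib, ← Finset.sum_mul, ← Complex.ofReal_sum, ← Complex.ofReal_sum,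
      Complex.normSq_add_mul_I, sq, sq, Finset.sum_mul_sum, Finset.sum_mul_sum,
      ← Finset.sum_add_distrib]
    refine Finset.sum_congr rfl fun s _ => ?_
    rw [← Finset.sum_add_distrib]
    refine Finset.sum_congr rfl fun r _ => ?_
    push_cast
    rw [show 2 * ((s : ℝ) - r) * x = 2 * s * x - 2 * r * x by ring, Real.cos_sub]
    ring
  simp_rw [h]
  rw [intervalIntegral.integral_finsetSum
    fun j _ => Continuous.intervalIntegrable (by fun_prop) _ _, Finset.mul_sum]
  refine Finset.sum_congr rfl fun s hs => ?_
  rw [intervalIntegral.integral_finsetSum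
    fun j _ => Continuous.intervalIntegrable (by fun_prop) _ _]
  simp_rw [intervalIntegral.integral_const_mul, integral_cos_two_mul_int]
  rw [Finset.sum_eq_single s]
  · simp; ring
  · intro r _ hr
    have : (s : ℤ) - r ≠ 0 := fun h => hr (by omega)
    simp [this]
  · exact fun h => absurd hs h

lemma prod_le_pow_of_sum {t : ℕ} (ht : 1 ≤ t) (x : Fin t → ℝ) (hx : ∀ i, 0 ≤ x i) {y : ℝ}
    (hy : ∑ i, x i = t * y) : ∏ i, x i ≤ y ^ t := by
  have ht0 : (0 : ℝ) < t := by exact_mod_cast ht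
  have h := Real.geom_mean_le_arith_mean Finset.univ (fun _ : Fin t => (1 : ℝ)) x
    (fun _ _ => zero_le_one) (by simpa using (by omega : 0 < t)) (fun i _ => hx i)
  simp only [Real.rpow_one, Finset.sum_const, Finset.card_univ, Fintype.card_fin, nsmul_eq_mul,
    mul_one, one_mul, hy] at h
  rw [mul_div_cancel_left₀ _ ht0.ne'] at h
  have hp : 0 ≤ ∏ i, x i := Finset.prod_nonneg fun i _ => hx i
  calc ∏ i, x i = ((∏ i, x i) ^ ((t : ℝ)⁻¹)) ^ t := by
        rw [Real.rpow_inv_natCast_pow hp (by omega)]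
    _ ≤ y ^ t := pow_le_pow_left₀ (Real.rpow_nonneg hp _) h t

/-- The modulus depends on c only through c(1-c) and is affine in it, so after AM-GM only the sum of
the c_i(1-c_i), the variance, matters. It holds for every real c, so the c_i need not be shown to
lie in [0,1]. -/
lemma normSq_one_add_mul_exp_sub_one (c x : ℝ) :
    Complex.normSq (1 + (c : ℂ) * (Complex.exp ((2 * x : ℝ) * Complex.I) - 1)) =
      1 - 4 * (c * (1 - c)) * Real.sin x ^ 2 := by
  have : (1 + (c : ℂ) * (Complex.exp ((2 * x : ℝ) * Complex.I) - 1)) =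
      ((1 + c * (Real.cos (2 * x) - 1) : ℝ) : ℂ) + ((c * Real.sin (2 * x) : ℝ) : ℂ) *
        Complex.I := by
    rw [Complex.exp_mul_I]; push_cast; ring
  rw [this, Complex.normSq_add_mul_I, Real.cos_two_mul, Real.sin_two_mul]
  have h := Real.sin_sq_add_cos_sq x
  have h2 : Real.cos x ^ 2 = 1 - Real.sin x ^ 2 := by linarith
  have : (c * (2 * Real.sin x * Real.cos x)) ^ 2 =
    4 * c ^ 2 * Real.sin x ^ 2 * Real.cos x ^ 2 := by ring
  rw [this, h2]; ring

/-- The collision probability of a hypergeometric variable (times `C(a + b, t) ^ 2`). -/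
noncomputable def hypCollision (a b t : ℕ) : ℕ :=
  ∑ s ∈ Finset.range (t + 1), (a.choose s * b.choose (t - s)) ^ 2

/-- By Parseval the collision sum is the mean of the squared modulus of the generating polynomial on
the unit circle. AM-GM over its t factors replaces each by their average 1 - (1-μ) sin² x = cos² x +
μ sin² x, where 1-μ is four times the variance divided by t. -/
lemma hypCollision_le {a b t : ℕ} (ht1 : 1 ≤ t) (ht : t ≤ a + b) (h2 : 2 ≤ a + b) {μ : ℝ}
    (hμ : μ = 1 - 4 * ((a : ℝ) * b * (a + b - t) / ((a + b) ^ 2 * (a + b - 1)))) :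
    (hypCollision a b t : ℝ) ≤ ((a + b).choose t : ℝ) ^ 2 *
      ∑ j ∈ Finset.range (t + 1), returnProb j * returnProb (t - j) * μ ^ j := by
  obtain ⟨c, hc, hs⟩ := exists_bernoulli_factorization ht1 ht h2
  set y := (a : ℝ) * b * (a + b - t) / ((a + b) ^ 2 * (a + b - 1)) with hy
  have hpi := Real.pi_pos
  have hP := integral_normSq_sum_exp (t + 1) fun s => (a.choose s : ℝ) * (b.choose (t - s) : ℝ)
  have hL : (hypCollision a b t : ℝ) =
      ∑ s ∈ Finset.range (t + 1), ((a.choose s : ℝ) * (b.choose (t - s) : ℝ)) ^ 2 := by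
    simp [hypCollision]
  rw [hL]
  refine le_of_mul_le_mul_left ?_ hpi
  rw [← hP, mul_left_comm, ← integral_cos_sq_add_mul_sin_sq_pow,
    ← intervalIntegral.integral_const_mul]
  refine intervalIntegral.integral_mono_on hpi.le
    (Continuous.intervalIntegrable (by fun_prop) _ _)
    (Continuous.intervalIntegrable (by fun_prop) _ _) fun x _ => ?_
  push_cast
  have hcx := hc (Complex.exp ((2 * x : ℝ) * Complex.I))
  push_cast at hcx
  rw [hcx, map_mul, map_prod]
  have e1 : Complex.normSq ((a + b).choose t : ℂ) = ((a + b).choose t : ℝ) ^ 2 := by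
    rw [← Complex.ofReal_natCast, Complex.normSq_ofReal, sq]
  rw [e1]
  refine mul_le_mul_of_nonneg_left ?_ (by positivity)
  refine prod_le_pow_of_sum ht1 _ (fun i => Complex.normSq_nonneg _) ?_
  have e2 : ∀ i, Complex.normSq (1 + (c i : ℂ) * (Complex.exp (2 * x * Complex.I) - 1)) =
      1 - 4 * (c i * (1 - c i)) * Real.sin x ^ 2 := by
    intro i
    have := normSq_one_add_mul_exp_sub_one (c i) x
    push_cast at this; exact this
  simp_rw [e2]
  rw [Finset.sum_sub_distrib, ← Finset.sum_mul, ← Finset.mul_sum, hs, hμ]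
  have := Real.sin_sq_add_cos_sq x
  simp
  linear_combination (-(t : ℝ)) * this

/-! ### The contribution of one row to the second-moment ratio. -/

/-- The probability C(h,t)²/C(2h,2t) that a fixed half splits a row evenly is r_t r_{h-t}/r_h. In
this form the factor r_t cancels against the one in the collision bound. -/
lemma choose_two_mul_mul_returnProb {h t : ℕ} (ht : t ≤ h) :
    ((2 * h).choose (2 * t) : ℝ) * returnProb t =
      (h.choose t : ℝ) ^ 2 * (returnProb h / returnProb (h - t)) := by
  have e := returnProb_mul_div ht
  have hA := returnProb_pos h
  have hB := returnProb_pos (h - t)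
  have hN : (0 : ℝ) < ((2 * h).choose (2 * t) : ℝ) := by
    exact_mod_cast Nat.choose_pos (by omega)
  field_simp at e ⊢
  linarith

lemma sqrt_mul_le_one_add {x y u v : ℝ} (hy : 0 ≤ y) (hu : 0 ≤ u) (hv : 0 ≤ v)
    (hxu : x ≤ 1 + u) (hyv : y ≤ 1 + v) : Real.sqrt (x * y) ≤ 1 + (u + v) / 2 := by
  refine Real.sqrt_le_iff.2 ⟨by positivity, ?_⟩
  have h1 : x * y ≤ (1 + u) * (1 + v) := mul_le_mul hxu hyv hy (by positivity)
  nlinarith [sq_nonneg (u - v)]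

-- Once r_t cancels, the main factor is √κ/√(1-μ) with κ close to τ = (H-t)/(H-1) and 1-μ = (1-ρ²)τ,
-- where ρ = (a-b)/H. Thus τ cancels too, and only errors of order ρ² and 1/H remain, uniformly in
-- t.
set_option maxHeartbeats 400000 in
lemma hypCollision_mul_choose_le {δ : ℝ} (hδ : 0 < δ) {a b t : ℕ}
    (ha : δ * (a + b) ≤ a) (hb : δ * (a + b) ≤ b) (ht : (t : ℝ) ≤ 0.49 * ((a : ℝ) + b)) :
    (hypCollision a b t : ℝ) * ((2 * (a + b)).choose (2 * t) : ℝ) ≤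
      ((a + b).choose t : ℝ) ^ 4 * (1 + (1 / δ ^ 2 + 1 + 1 / δ ^ 6) *
        (((a : ℝ) - b) ^ 2 / (a + b) ^ 2 + 1 / (a + b))) := by
  rcases Nat.eq_zero_or_pos t with rfl | htpos
  · simp [hypCollision]; positivity
  have ht1 : (1 : ℝ) ≤ t := by exact_mod_cast htpos
  have hh2 : (2 : ℝ) < (a : ℝ) + b := by norm_num at ht; linarith
  have htab : t ≤ a + b := by
    have : (t : ℝ) ≤ (a + b : ℕ) := by push_cast; norm_num at ht; linarith
    exact_mod_cast this
  have h2ab : 2 ≤ a + b := by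
    have : (2 : ℝ) < (a + b : ℕ) := by push_cast; exact hh2
    exact_mod_cast this.le
  set H : ℝ := (a : ℝ) + b with hH
  set ρ2 : ℝ := ((a : ℝ) - b) ^ 2 / H ^ 2 with hρ2
  have hH0 : 0 < H := by linarith
  have hH1 : 0 < H - 1 := by linarith
  have hρ0 : 0 ≤ ρ2 := by positivity
  have hab : 1 - ρ2 = 4 * (a * b) / H ^ 2 := by
    rw [hρ2, hH]; rw [hH] at hH0; field_simp; ring
  have hρδ : 4 * δ ^ 2 ≤ 1 - ρ2 := by
    rw [hab, le_div_iff₀ (by positivity)]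
    have : (δ * H) * (δ * H) ≤ a * b := mul_le_mul ha hb (by positivity) (by positivity)
    nlinarith
  have hρpos : 0 < 1 - ρ2 := by have : 0 < δ ^ 2 := by positivity
                                linarith
  have htH : (t : ℝ) ≤ 0.49 * H := ht
  norm_num at htH
  set τ : ℝ := (H - t) / (H - 1) with hτ
  have hτ1 : τ ≤ 1 := by rw [hτ, div_le_one hH1]; linarith
  -- The weight bound 0.49 makes this hold, which keeps 1-μ ≥ 2δ².
  have hτ2 : 1 / 2 ≤ τ := by rw [hτ, le_div_iff₀ hH1]; linarith
  have h1τ : 1 - τ ≤ t * (1 / H) := by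
    rw [hτ, one_sub_div hH1.ne', mul_one_div, div_le_div_iff₀ hH1 hH0]; nlinarith
  set μ : ℝ := 1 - (1 - ρ2) * τ with hμ
  have hμ0 : 0 ≤ μ := by rw [hμ]; nlinarith
  have hlam : 2 * δ ^ 2 ≤ 1 - μ := by rw [hμ]; nlinarith
  have hlam0 : 0 < 1 - μ := lt_of_lt_of_le (by positivity) hlam
  have hμ1 : μ < 1 := by linarith
  -- The factor t is kept to cancel the t in the denominator of the correction term of `G`.
  have hμt : μ ≤ t * (ρ2 + 1 / H) := by
    have e1 : μ ≤ ρ2 + (1 - τ) := by rw [hμ]; nlinarith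
    have : ρ2 ≤ t * ρ2 := by nlinarith
    linarith
  have hcol := hypCollision_le htpos htab h2ab (μ := μ) (by
    change μ = 1 - 4 * ((a : ℝ) * b * (H - t) / (H ^ 2 * (H - 1)))
    rw [hμ, hab, hτ]; field_simp)
  have hgen := sum_returnProb_mul_returnProb_mul_pow_le hμ0 hμ1 htpos
  have hN : (0 : ℝ) < ((a + b).choose t : ℝ) := by exact_mod_cast Nat.choose_pos htab
  set G := 1 / Real.sqrt (1 - μ) + 4 * μ / (t * (1 - μ) ^ 3) with hG
  have hG0 : 0 ≤ G := by positivity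
  set κ := (2 * (H - t) + 1) / (2 * H + 1) with hκ
  have hHt : 0 < H - t := by linarith
  have hκ0 : 0 ≤ κ := by positivity
  have hratio : returnProb (a + b) / returnProb (a + b - t) ≤ Real.sqrt κ := by
    have := returnProb_div_le htab
    push_cast at this; exact this
  have hκ1 : Real.sqrt κ ≤ 1 := by
    refine Real.sqrt_le_one.2 ?_
    rw [hκ, div_le_one (by positivity)]; linarith
  have step1 : (hypCollision a b t : ℝ) * ((2 * (a + b)).choose (2 * t) : ℝ) ≤
      ((a + b).choose t : ℝ) ^ 4 * (Real.sqrt κ * G) := by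
    calc _ ≤ (((a + b).choose t : ℝ) ^ 2 * (returnProb t * G)) *
          ((2 * (a + b)).choose (2 * t) : ℝ) := by
          gcongr
          exact hcol.trans (mul_le_mul_of_nonneg_left hgen (by positivity))
      _ = ((a + b).choose t : ℝ) ^ 2 *
          ((((2 * (a + b)).choose (2 * t) : ℝ) * returnProb t) * G) := by ring
      _ = ((a + b).choose t : ℝ) ^ 4 *
          ((returnProb (a + b) / returnProb (a + b - t)) * G) := by
          rw [choose_two_mul_mul_returnProb htab]; ring
      _ ≤ _ := by gcongr
  refine step1.trans (mul_le_mul_of_nonneg_left ?_ (by positivity))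
  have p1 : Real.sqrt κ * (1 / Real.sqrt (1 - μ)) ≤ 1 + (1 / δ ^ 2 * ρ2 + 1 / H) / 2 := by
    have e : Real.sqrt κ * (1 / Real.sqrt (1 - μ)) =
        Real.sqrt (1 / (1 - ρ2) * (κ / τ)) := by
      rw [mul_one_div, ← Real.sqrt_div hκ0]
      congr 1
      rw [hμ, sub_sub_cancel]
      field_simp
    rw [e]
    have x1 : 1 / (1 - ρ2) ≤ 1 + 1 / δ ^ 2 * ρ2 := by
      rw [div_le_iff₀ hρpos]
      have : 1 ≤ 1 / δ ^ 2 * (1 - ρ2) := by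
        rw [one_div_mul_eq_div, le_div_iff₀ (by positivity)]
        linarith [sq_nonneg δ]
      have e1 := mul_le_mul_of_nonneg_left this hρ0
      linarith [show (1 + 1 / δ ^ 2 * ρ2) * (1 - ρ2) =
        1 - ρ2 + ρ2 * (1 / δ ^ 2 * (1 - ρ2)) by ring]
    have x2 : κ / τ ≤ 1 + 1 / H := by
      rw [hκ, hτ, div_div_div_eq, div_le_iff₀ (by positivity)]
      have e2 : (1 + 1 / H) * ((2 * H + 1) * (H - t)) =
          2 * (H * (H - t)) + 3 * (H - t) + 1 / H * (H - t) := by field_simp; ring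
      have e3 : 0 ≤ 1 / H * (H - t) := by positivity
      rw [e2]
      linarith [show (2 * (H - t) + 1) * (H - 1) = 2 * (H * (H - t)) - 2 * (H - t) + H - 1 by ring]
    exact sqrt_mul_le_one_add (by positivity) (by positivity) (by positivity)
      x1 x2
  have p2 : Real.sqrt κ * (4 * μ / (t * (1 - μ) ^ 3)) ≤ 1 / δ ^ 6 * (ρ2 + 1 / H) := by
    have y0 : 0 ≤ 4 * μ / (t * (1 - μ) ^ 3) := by positivity
    refine (mul_le_of_le_one_left y0 hκ1).trans ?_
    rw [div_le_iff₀ (by positivity)]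
    have y1 : (2 * δ ^ 2) ^ 3 ≤ (1 - μ) ^ 3 := pow_le_pow_left₀ (by positivity) hlam 3
    have y2 : 0 ≤ ρ2 + 1 / H := by positivity
    calc 4 * μ ≤ 8 * (t * (ρ2 + 1 / H)) := by linarith
      _ = 1 / δ ^ 6 * (ρ2 + 1 / H) * (t * (2 * δ ^ 2) ^ 3) := by field_simp; ring
      _ ≤ _ := by gcongr
  rw [hG, mul_add]
  refine (add_le_add p1 p2).trans ?_
  have q1 : 0 ≤ 1 / δ ^ 2 * ρ2 := by positivity
  have q2 : 0 ≤ 1 / H := by positivity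
  have q3 : 0 ≤ 1 / δ ^ 2 * (1 / H) := by positivity
  linarith [show (1 / δ ^ 2 + 1 + 1 / δ ^ 6) * (ρ2 + 1 / H) = 1 / δ ^ 2 * ρ2 + 1 / δ ^ 2 * (1 / H) +
    ρ2 + 1 / H + 1 / δ ^ 6 * (ρ2 + 1 / H) by ring]

lemma hypCollision_le_choose_sq (a b t : ℕ) :
    hypCollision a b t ≤ (a + b).choose t ^ 2 := by
  rw [Nat.add_choose_eq, Finset.Nat.sum_antidiagonal_eq_sum_range_succ_mk, hypCollision]
  exact Finset.sum_sq_le_sq_sum_of_nonneg fun _ _ => Nat.zero_le _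

/-- Crude bound valid for every overlap: the collision probability is at most 1, and a fixed half
splits a row with probability at least 1/(2√h). -/
lemma hypCollision_mul_choose_le_sqrt {a b t : ℕ} (ht : t ≤ a + b) (h1 : 1 ≤ a + b) :
    (hypCollision a b t : ℝ) * ((2 * (a + b)).choose (2 * t) : ℝ) ≤
      ((a + b).choose t : ℝ) ^ 4 * (2 * Real.sqrt (a + b : ℕ)) := by
  have hs1 : 1 ≤ Real.sqrt (a + b : ℕ) := Real.one_le_sqrt.2 (by exact_mod_cast h1)
  rcases Nat.eq_zero_or_pos t with rfl | htpos
  · have e : (hypCollision a b 0 : ℝ) * ((2 * (a + b)).choose (2 * 0) : ℝ) = 1 := by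
      simp [hypCollision]
    rw [e, Nat.choose_zero_right]; push_cast at hs1 ⊢; linarith
  have hc : (hypCollision a b t : ℝ) ≤ ((a + b).choose t : ℝ) ^ 2 := by
    exact_mod_cast hypCollision_le_choose_sq a b t
  have h2 : ((2 * (a + b)).choose (2 * t) : ℝ) ≤
      ((a + b).choose t : ℝ) ^ 2 * (2 * Real.sqrt (a + b : ℕ)) := by
    have e := choose_two_mul_mul_returnProb ht
    have hp := returnProb_pos t
    have hA := returnProb_pos (a + b)
    have hB := returnProb_pos (a + b - t)
    have e1 : returnProb (a + b) / returnProb (a + b - t) ≤ 1 := by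
      rw [div_le_one hB]; exact returnProb_antitone (Nat.sub_le _ _)
    have e2 := one_le_mul_returnProb htpos
    have e3 : Real.sqrt t ≤ Real.sqrt (a + b : ℕ) := Real.sqrt_le_sqrt (by exact_mod_cast ht)
    have hM : (0 : ℝ) ≤ ((2 * (a + b)).choose (2 * t) : ℝ) := by positivity
    calc ((2 * (a + b)).choose (2 * t) : ℝ)
        ≤ ((2 * (a + b)).choose (2 * t) : ℝ) * (2 * Real.sqrt t * returnProb t) :=
          le_mul_of_one_le_right hM e2
      _ = (((2 * (a + b)).choose (2 * t) : ℝ) * returnProb t) * (2 * Real.sqrt t) := by ring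
      _ = ((a + b).choose t : ℝ) ^ 2 * (returnProb (a + b) / returnProb (a + b - t)) *
          (2 * Real.sqrt t) := by rw [e]
      _ ≤ ((a + b).choose t : ℝ) ^ 2 * 1 * (2 * Real.sqrt (a + b : ℕ)) := by gcongr
      _ = _ := by ring
  calc _ ≤ ((a + b).choose t : ℝ) ^ 2 *
      (((a + b).choose t : ℝ) ^ 2 * (2 * Real.sqrt (a + b : ℕ))) := by gcongr
    _ = _ := by ring

/-! ### Exponential moments of the overlap. -/

lemma choose_le_two_pow_div_sqrt {h : ℕ} (hh : 1 ≤ h) (a : ℕ) :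
    (h.choose a : ℝ) * Real.sqrt h ≤ Real.sqrt 2 * 2 ^ h := by
  have key : ∀ k : ℕ, returnProb k * Real.sqrt (2 * k : ℕ) ≤ Real.sqrt 2 := by
    intro k
    have h1 := returnProb_le k
    push_cast
    rw [Real.sqrt_mul (by norm_num)]
    nlinarith [Real.sqrt_nonneg 2]
  have hmid : (h.choose a : ℝ) ≤ (h.choose (h / 2) : ℝ) := by
    exact_mod_cast Nat.choose_le_middle a h
  refine (mul_le_mul_of_nonneg_right hmid (Real.sqrt_nonneg _)).trans ?_
  rcases Nat.even_or_odd' h with ⟨k, rfl | rfl⟩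
  · have : ((2 * k).choose (2 * k / 2) : ℝ) = returnProb k * 2 ^ (2 * k) := by
      rw [Nat.mul_div_cancel_left k (by norm_num), returnProb, Nat.centralBinom, pow_mul]
      norm_num
    rw [this, mul_right_comm]
    exact mul_le_mul_of_nonneg_right (key k) (by positivity)
  · have : ((2 * k + 1).choose ((2 * k + 1) / 2) : ℝ) = returnProb (k + 1) * 2 ^ (2 * k + 1) := by
      rw [show (2 * k + 1) / 2 = k by omega, returnProb]
      have h1 : Nat.centralBinom (k + 1) = 2 * (2 * k + 1).choose k := by
        rw [Nat.centralBinom, show 2 * (k + 1) = 2 * k + 1 + 1 by ring, Nat.choose_succ_succ,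
          Nat.choose_symm_half]; ring
      rw [h1, show (4 : ℝ) ^ (k + 1) = 2 * 2 ^ (2 * k + 1) by
        rw [show (4 : ℝ) = 2 ^ 2 by norm_num, ← pow_mul]; ring]
      push_cast
      field_simp
    rw [this, mul_right_comm]
    refine mul_le_mul_of_nonneg_right (le_trans ?_ (key (k + 1))) (by positivity)
    refine mul_le_mul_of_nonneg_left (Real.sqrt_le_sqrt ?_) (returnProb_pos _).le
    exact_mod_cast (by omega)

lemma four_pow_le_choose_mul_sqrt {h : ℕ} (hh : 1 ≤ h) :
    (4 : ℝ) ^ h ≤ ((2 * h).choose h : ℝ) * (2 * Real.sqrt h) := by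
  have h1 := one_le_mul_returnProb hh
  rw [returnProb, Nat.centralBinom, mul_div_assoc', le_div_iff₀ (by positivity)] at h1
  linarith

/-- The hypergeometric weights are dominated by binomial weights. -/
lemma choose_sq_le_choose_mul {h : ℕ} (hh : 1 ≤ h) (a : ℕ) :
    (h.choose a : ℝ) ^ 2 ≤ ((2 * h).choose h : ℝ) * (3 * ((h.choose a : ℝ) / 2 ^ h)) := by
  have h1 := choose_le_two_pow_div_sqrt hh a
  have h2 := four_pow_le_choose_mul_sqrt hh
  have hs : 0 < Real.sqrt h := Real.sqrt_pos.2 (by exact_mod_cast hh)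
  have hc : (0 : ℝ) ≤ h.choose a := by positivity
  have h3 : (h.choose a : ℝ) * 2 ^ h ≤ 3 * ((2 * h).choose h : ℝ) := by
    refine le_of_mul_le_mul_right ?_ hs
    have e4 : (4 : ℝ) ^ h = 2 ^ h * 2 ^ h := by rw [← mul_pow]; norm_num
    have s2 : Real.sqrt 2 * 2 ≤ 3 := by
      nlinarith [Real.sq_sqrt (show (0:ℝ) ≤ 2 by norm_num), Real.sqrt_nonneg 2]
    calc (h.choose a : ℝ) * 2 ^ h * Real.sqrt h = (h.choose a : ℝ) * Real.sqrt h * 2 ^ h := by ring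
      _ ≤ (Real.sqrt 2 * 2 ^ h) * 2 ^ h := by gcongr
      _ = Real.sqrt 2 * 4 ^ h := by rw [e4]; ring
      _ ≤ Real.sqrt 2 * (((2 * h).choose h : ℝ) * (2 * Real.sqrt h)) := by gcongr
      _ = (Real.sqrt 2 * 2) * (((2 * h).choose h : ℝ) * Real.sqrt h) := by ring
      _ ≤ 3 * (((2 * h).choose h : ℝ) * Real.sqrt h) := by gcongr
      _ = _ := by ring
  calc (h.choose a : ℝ) ^ 2 = (h.choose a : ℝ) * ((h.choose a : ℝ) * 2 ^ h) / 2 ^ h := by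
        field_simp
    _ ≤ (h.choose a : ℝ) * (3 * ((2 * h).choose h : ℝ)) / 2 ^ h := by gcongr
    _ = _ := by ring

lemma exp_two_mul_sub_sq (d y : ℝ) :
    Real.exp (2 * d * y - y ^ 2) = Real.exp (d ^ 2) * Real.exp (-1 * (y - d) ^ 2) := by
  rw [← Real.exp_add]; congr 1; ring

lemma exp_sq_eq_integral (d : ℝ) :
    Real.exp (d ^ 2) * Real.sqrt Real.pi = ∫ y : ℝ, Real.exp (2 * d * y - y ^ 2) := by
  simp_rw [exp_two_mul_sub_sq]
  rw [integral_const_mul, integral_sub_right_eq_self (fun y => Real.exp (-1 * y ^ 2)) d,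
    integral_gaussian, div_one]

lemma integrable_exp_mul_sub_sq (d : ℝ) :
    Integrable fun y : ℝ => Real.exp (2 * d * y - y ^ 2) := by
  simp_rw [exp_two_mul_sub_sq]
  exact ((integrable_exp_neg_mul_sq one_pos).comp_sub_right d).const_mul _

lemma sum_choose_mul_exp (h : ℕ) (y : ℝ) :
    ∑ a ∈ Finset.range (h + 1), (h.choose a : ℝ) / 2 ^ h * Real.exp ((2 * a - h) * y) =
      Real.cosh y ^ h := by
  rw [Real.cosh_eq, div_pow, add_pow, Finset.sum_div]
  refine Finset.sum_congr rfl fun a ha => ?_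
  have ha' : a ≤ h := Nat.lt_succ_iff.1 (Finset.mem_range.1 ha)
  rw [← Real.exp_nat_mul, ← Real.exp_nat_mul, ← Real.exp_add, Nat.cast_sub ha']
  rw [show (a : ℝ) * y + ((h : ℝ) - a) * -y = (2 * a - h) * y by ring]
  ring

/-- Gaussian linearisation: exp(d²) is a Gaussian average of exp(2dy), which turns the sum into the
binomial moment generating function cosh(y/√h)^h ≤ exp(y²/2). What remains is a Gaussian integral,
with value √2. -/
lemma sum_binomial_exp_sq_le {h : ℕ} (hh : 1 ≤ h) :
    ∑ a ∈ Finset.range (h + 1), (h.choose a : ℝ) / 2 ^ h *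
      Real.exp ((2 * (a : ℝ) - h) ^ 2 / (4 * h)) ≤ 2 := by
  have hh0 : (0 : ℝ) < h := by exact_mod_cast hh
  have hs : 0 < Real.sqrt h := Real.sqrt_pos.2 hh0
  have hpi : 0 < Real.sqrt Real.pi := Real.sqrt_pos.2 Real.pi_pos
  refine le_of_mul_le_mul_right ?_ hpi
  have e : ∀ a : ℕ, (2 * (a : ℝ) - h) ^ 2 / (4 * h) = ((2 * (a : ℝ) - h) / (2 * Real.sqrt h)) ^ 2 := by
    intro a; rw [div_pow, mul_pow, Real.sq_sqrt hh0.le]; norm_num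
  rw [Finset.sum_mul]
  simp_rw [e, mul_assoc, exp_sq_eq_integral, ← integral_const_mul]
  rw [← integral_finsetSum _ fun a _ => (integrable_exp_mul_sub_sq _).const_mul _]
  have hint : Integrable fun y : ℝ => Real.exp (-(1 / 2) * y ^ 2) :=
    integrable_exp_neg_mul_sq (by norm_num)
  calc _ ≤ ∫ y : ℝ, Real.exp (-(1 / 2) * y ^ 2) := by
        refine integral_mono (integrable_finsetSum _ fun a _ =>
          (integrable_exp_mul_sub_sq _).const_mul _) hint fun y => ?_
        have e2 : ∀ a : ℕ, (h.choose a : ℝ) / 2 ^ h *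
            Real.exp (2 * ((2 * (a : ℝ) - h) / (2 * Real.sqrt h)) * y - y ^ 2) =
            (h.choose a : ℝ) / 2 ^ h * Real.exp ((2 * a - h) * (y / Real.sqrt h)) *
              Real.exp (-y ^ 2) := by
          intro a
          rw [mul_assoc _ (Real.exp _) (Real.exp _), ← Real.exp_add]
          congr 2
          field_simp; ring
        simp_rw [e2]
        rw [← Finset.sum_mul, sum_choose_mul_exp]
        calc Real.cosh (y / Real.sqrt h) ^ h * Real.exp (-y ^ 2)
            ≤ Real.exp ((y / Real.sqrt h) ^ 2 / 2) ^ h * Real.exp (-y ^ 2) := by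
              gcongr
              exact Real.cosh_le_exp_half_sq _
          _ = _ := by
              rw [← Real.exp_nat_mul, ← Real.exp_add, div_pow, Real.sq_sqrt hh0.le]
              congr 1; field_simp; ring
    _ = Real.sqrt (Real.pi / (1 / 2)) := integral_gaussian _
    _ = Real.sqrt 2 * Real.sqrt Real.pi := by
        rw [← Real.sqrt_mul (by norm_num)]; congr 1; ring
    _ ≤ 2 * Real.sqrt Real.pi := by
        gcongr
        nlinarith [Real.sq_sqrt (show (0:ℝ) ≤ 2 by norm_num), Real.sqrt_nonneg 2]

lemma sum_choose_sq_eq (h : ℕ) :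
    ∑ a ∈ Finset.range (h + 1), (h.choose a : ℝ) ^ 2 = ((2 * h).choose h : ℝ) := by
  exact_mod_cast Nat.sum_range_choose_sq h

/-- Exponential moments of the squared deviation of the balanced hypergeometric law. -/
lemma sum_choose_sq_mul_exp_le {h : ℕ} (hh : 1 ≤ h) {θ : ℝ} (h0 : 0 ≤ θ) (h1 : θ ≤ 1) :
    ∑ a ∈ Finset.range (h + 1), (h.choose a : ℝ) ^ 2 *
      Real.exp (θ * ((2 * (a : ℝ) - h) ^ 2 / (4 * h))) ≤
        ((2 * h).choose h : ℝ) * Real.exp (2 * θ) := by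
  set M : ℝ := ((2 * h).choose h : ℝ) with hM
  have hM0 : 0 < M := by rw [hM]; exact_mod_cast Nat.choose_pos (by omega)
  set Y : ℕ → ℝ := fun a => Real.exp ((2 * (a : ℝ) - h) ^ 2 / (4 * h)) with hY
  have hw : ∑ a ∈ Finset.range (h + 1), (h.choose a : ℝ) ^ 2 / M = 1 := by
    rw [← Finset.sum_div, sum_choose_sq_eq, div_self hM0.ne']
  -- Jensen for the concave power θ: E[Y^θ] ≤ (E Y)^θ ≤ 6^θ ≤ exp(2θ). The bound therefore tends to
  -- 1 as θ tends to 0, which a fixed constant would not do.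
  have hJ := (Real.concaveOn_rpow h0 h1).le_map_sum (t := Finset.range (h + 1))
    (w := fun a => (h.choose a : ℝ) ^ 2 / M) (p := Y) (fun a _ => by positivity) hw
    (fun a _ => (Real.exp_pos _).le)
  simp only [smul_eq_mul] at hJ
  have hE : ∑ a ∈ Finset.range (h + 1), (h.choose a : ℝ) ^ 2 / M * Y a ≤ 6 := by
    calc _ ≤ ∑ a ∈ Finset.range (h + 1), 3 * ((h.choose a : ℝ) / 2 ^ h * Y a) := by
          refine Finset.sum_le_sum fun a _ => ?_
          rw [← mul_assoc]
          refine mul_le_mul_of_nonneg_right ?_ (Real.exp_pos _).le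
          rw [div_le_iff₀' hM0]
          exact choose_sq_le_choose_mul hh a
      _ ≤ 3 * 2 := by
          rw [← Finset.mul_sum]
          exact mul_le_mul_of_nonneg_left (sum_binomial_exp_sq_le hh) (by norm_num)
      _ = 6 := by norm_num
  have h6 : (6 : ℝ) ≤ Real.exp 2 := by
    have := Real.quadratic_le_exp_of_nonneg (show (0 : ℝ) ≤ 2 by norm_num)
    have h1 := Real.exp_one_gt_d9
    have : Real.exp 2 = Real.exp 1 * Real.exp 1 := by rw [← Real.exp_add]; norm_num
    rw [this]; nlinarith
  have hfin : (∑ a ∈ Finset.range (h + 1), (h.choose a : ℝ) ^ 2 / M * Y a) ^ θ ≤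
      Real.exp (2 * θ) := by
    rw [Real.exp_mul]
    exact Real.rpow_le_rpow (Finset.sum_nonneg fun a _ => by positivity) (hE.trans h6) h0
  have hL := hJ.trans hfin
  rw [← div_le_iff₀' hM0, Finset.sum_div]
  refine le_trans (le_of_eq (Finset.sum_congr rfl fun a _ => ?_)) hL
  rw [hY]
  simp only
  rw [← Real.exp_mul, mul_comm θ]
  ring

/-! ### Asymptotic estimates in the regime n ≥ C m log m. -/

/-- From C(h,a) x^a ≤ (1+x)^h ≤ exp(xh): fix x small against η, then take δ so small that x^(-a)
also costs at most exp(ηh/2). -/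
lemma choose_le_exp_of_le {η : ℝ} (hη : 0 < η) :
    ∃ δ : ℝ, 0 < δ ∧ ∀ h a : ℕ, (a : ℝ) ≤ δ * h → (h.choose a : ℝ) ≤ Real.exp (η * h) := by
  set x := min 1 (η / 2) with hx
  have hx0 : 0 < x := lt_min one_pos (by positivity)
  have hx1 : x ≤ 1 := min_le_left _ _
  have hx2 : x ≤ η / 2 := min_le_right _ _
  have hlog : Real.log x ≤ 0 := Real.log_nonpos hx0.le hx1
  have hden : 0 < 1 - Real.log x := by linarith
  refine ⟨η / 2 / (1 - Real.log x), by positivity, fun h a ha => ?_⟩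
  rcases Nat.lt_or_ge h a with hlt | hle
  · rw [Nat.choose_eq_zero_of_lt hlt]; simpa using (Real.exp_pos _).le
  have h1 : (h.choose a : ℝ) * x ^ a ≤ (x + 1) ^ h := by
    rw [add_pow]
    have := Finset.single_le_sum (f := fun k => x ^ k * 1 ^ (h - k) * (h.choose k : ℝ))
      (fun k _ => by positivity) (Finset.mem_range.2 (Nat.lt_succ_of_le hle))
    simp only [one_pow, mul_one] at this ⊢
    linarith
  have h2 : (x + 1) ^ h ≤ Real.exp (η / 2 * h) := by
    calc (x + 1) ^ h ≤ Real.exp x ^ h := pow_le_pow_left₀ (by positivity) (Real.add_one_le_exp x) h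
      _ = Real.exp (x * h) := by rw [← Real.exp_nat_mul, mul_comm]
      _ ≤ _ := Real.exp_le_exp.2 (by gcongr)
  have h3 : x ^ a = Real.exp (a * Real.log x) := by
    rw [Real.exp_nat_mul, Real.exp_log hx0]
  have h4 : (a : ℝ) * (1 - Real.log x) ≤ η / 2 * h := by
    have := mul_le_mul_of_nonneg_right ha hden.le
    calc _ ≤ _ := this
      _ = _ := by field_simp
  have ha0 : (0 : ℝ) ≤ a := by positivity
  rw [h3] at h1
  calc (h.choose a : ℝ) = (h.choose a : ℝ) * Real.exp (a * Real.log x) *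
        Real.exp (-(a * Real.log x)) := by
        rw [mul_assoc, ← Real.exp_add, add_neg_cancel, Real.exp_zero, mul_one]
    _ ≤ Real.exp (η / 2 * h) * Real.exp (η / 2 * h) := by
        gcongr
        · exact h1.trans h2
        · linarith
    _ = _ := by rw [← Real.exp_add]; congr 1; ring

/-- If m exceeded κn/log n, then log m would be at least log n - log log n + log κ, so C m log m
would exceed n because Cκ > 1. It replaces log m by log n at the cost of any κ > 1/C. -/
lemma eventually_mul_log_le {C κ : ℝ} (hC : 0 < C) (hκ : C⁻¹ < κ) :
    ∀ᶠ n : ℕ in Filter.atTop, ∀ m : ℕ, C * (m : ℝ) * Real.log m ≤ n →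
      (m : ℝ) * Real.log n ≤ κ * n := by
  have hκ0 : 0 < κ := lt_trans (by positivity) hκ
  have hCκ : 1 < C * κ := by
    have := mul_lt_mul_of_pos_left hκ hC
    rwa [mul_inv_cancel₀ hC.ne'] at this
  set c := 1 - 1 / (C * κ) with hc
  have hc0 : 0 < c := by
    rw [hc, sub_pos, div_lt_one (by positivity)]; exact hCκ
  have hlog : Filter.Tendsto (fun n : ℕ => Real.log n) Filter.atTop Filter.atTop :=
    Real.tendsto_log_atTop.comp tendsto_natCast_atTop_atTop
  have e1 : ∀ᶠ n : ℕ in Filter.atTop, Real.log (Real.log n) ≤ c / 2 * Real.log n := by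
    have h1 := hlog.eventually (Real.isLittleO_log_id_atTop.bound (half_pos hc0))
    filter_upwards [h1, hlog.eventually_ge_atTop 0] with n hn hn0
    simp only [id, Real.norm_eq_abs, abs_of_nonneg hn0] at hn
    exact (le_abs_self _).trans hn
  filter_upwards [e1, hlog.eventually_ge_atTop (-Real.log κ / (c / 2)),
    hlog.eventually_gt_atTop 0, Filter.eventually_gt_atTop 0] with n h1 h2 h3 h4 m hm
  by_contra! hlt
  have hn0 : (0 : ℝ) < n := by exact_mod_cast h4
  have hm0 : (0 : ℝ) < m := by
    by_contra! h
    have : (m : ℝ) * Real.log n ≤ 0 := mul_nonpos_of_nonpos_of_nonneg h h3.le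
    have : 0 < κ * n := by positivity
    linarith
  have hl : Real.log κ + Real.log n - Real.log (Real.log n) ≤ Real.log m := by
    rw [← Real.log_mul hκ0.ne' hn0.ne', ← Real.log_div (by positivity) h3.ne']
    refine Real.log_le_log (by positivity) ?_
    rw [div_le_iff₀ h3]; exact hlt.le
  rw [div_le_iff₀ (half_pos hc0)] at h2
  have hl2 : 1 / (C * κ) * Real.log n ≤ Real.log m := by
    have : 1 / (C * κ) * Real.log n = Real.log n - c * Real.log n := by rw [hc]; ring
    linarith
  have : (m : ℝ) * Real.log n / κ ≤ C * m * Real.log m := by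
    calc (m : ℝ) * Real.log n / κ = C * m * (1 / (C * κ) * Real.log n) := by field_simp
      _ ≤ _ := by gcongr
  have h5 : (n : ℝ) < m * Real.log n / κ := by rw [lt_div_iff₀ hκ0]; linarith
  linarith

lemma eventually_le_mul (κ : ℝ) {γ : ℝ} (hγ : 0 < γ) :
    ∀ᶠ n : ℕ in Filter.atTop, ∀ m : ℕ, (m : ℝ) * Real.log n ≤ κ * n → (m : ℝ) ≤ γ * n := by
  have hlog : Filter.Tendsto (fun n : ℕ => Real.log n) Filter.atTop Filter.atTop :=
    Real.tendsto_log_atTop.comp tendsto_natCast_atTop_atTop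
  filter_upwards [hlog.eventually_ge_atTop (κ / γ), hlog.eventually_gt_atTop 0] with n h1 h2 m hm
  rw [div_le_iff₀ hγ] at h1
  refine le_of_mul_le_mul_right ?_ h2
  have : κ * n ≤ Real.log n * γ * n := by gcongr
  linarith

lemma eventually_poly_le_exp {η ε : ℝ} (hη : 0 < η) (hε : 0 < ε) :
    ∀ᶠ h : ℕ in Filter.atTop, ((h : ℝ) + 1) * (2 * Real.sqrt h) ≤ ε * Real.exp (η * h) := by
  have ht : Filter.Tendsto (fun n : ℕ => (n : ℝ)) Filter.atTop Filter.atTop :=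
    tendsto_natCast_atTop_atTop
  filter_upwards [ht.eventually_ge_atTop (24 / (ε * η ^ 3)), ht.eventually_ge_atTop 1]
    with h h1 h2
  rw [div_le_iff₀ (by positivity)] at h1
  have h3 := Real.pow_div_factorial_le_exp (η * h) (by positivity) 3
  have h4 : Real.sqrt h ≤ h := by
    rw [Real.sqrt_le_left (by positivity)]; nlinarith
  have h5 : ε * ((η * h) ^ 3 / 6) ≤ ε * Real.exp (η * h) := by
    refine mul_le_mul_of_nonneg_left ?_ hε.le
    simpa [Nat.factorial] using h3
  refine le_trans ?_ h5
  calc ((h : ℝ) + 1) * (2 * Real.sqrt h) ≤ (h + h) * (2 * h) := by gcongr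
    _ = 24 * h ^ 2 / 6 := by ring
    _ ≤ (h * (ε * η ^ 3)) * h ^ 2 / 6 := by gcongr
    _ = _ := by ring

lemma two_mul_sqrt_eq_exp {h : ℕ} (hh : 0 < h) :
    2 * Real.sqrt h = Real.exp ((Real.log 2 + Real.log (2 * h : ℕ)) / 2) := by
  have hh0 : (0 : ℝ) < h := by exact_mod_cast hh
  push_cast
  rw [← Real.log_mul (by norm_num) (by positivity), ← Real.log_sqrt (by positivity),
    Real.exp_log (by positivity), show (2 : ℝ) * (2 * h) = 2 ^ 2 * h by ring,
    Real.sqrt_mul (by positivity), Real.sqrt_sq (by norm_num)]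

lemma tendsto_two_mul_atTop : Filter.Tendsto (fun h : ℕ => 2 * h) Filter.atTop Filter.atTop :=
  Filter.tendsto_atTop_mono (fun h => by simp only [id]; omega) Filter.tendsto_id

lemma prod_le_prod_mul_pow {m : ℕ} {f g : Fin m → ℝ} {c : ℝ} (hf : ∀ i, 0 ≤ f i)
    (hfg : ∀ i, f i ≤ g i * c) : ∏ i, f i ≤ (∏ i, g i) * c ^ m := by
  have h := Finset.prod_le_prod (fun i (_ : i ∈ Finset.univ) => hf i) fun i _ => hfg i
  rwa [Finset.prod_mul_distrib, Finset.prod_const, Finset.card_univ, Fintype.card_fin] at h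

/-- Here (2√h)^m = exp(m(log 2 + log 2h)/2) ≤ exp((κ+η)h). With exp(2ηh) for the squared binomial
and exp(ηh) for the polynomial factors, the exponent is (κ+4η)h ≤ 2h log 2, that is, at most 4^h.
The last factor 2√h passes from 4^h to C(2h,h). -/
lemma eventually_outer_le {κ η ε : ℝ} (hη : 0 < η) (hκ : κ + 4 * η ≤ 2 * Real.log 2)
    (hε : 0 < ε) :
    ∀ᶠ h : ℕ in Filter.atTop, ∀ m : ℕ, (m : ℝ) * Real.log (2 * h : ℕ) ≤ κ * (2 * h : ℕ) →
      ((h : ℝ) + 1) * (Real.exp (2 * η * h) * (2 * Real.sqrt h) ^ m) * (2 * Real.sqrt h) ≤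
        ε * 4 ^ h := by
  filter_upwards [eventually_poly_le_exp hη hε, Filter.eventually_gt_atTop 0,
    tendsto_two_mul_atTop.eventually (eventually_le_mul κ hη)] with h h1 h2 h3 m hm
  have hm2 := h3 m hm
  have hh0 : (0 : ℝ) < h := by exact_mod_cast h2
  have hlog2 : Real.log 2 ≤ 1 := by
    have := Real.log_two_lt_d9; linarith
  have hpow : (2 * Real.sqrt h) ^ m ≤ Real.exp ((κ + η) * h) := by
    rw [two_mul_sqrt_eq_exp h2, ← Real.exp_nat_mul, Real.exp_le_exp]
    push_cast at hm hm2 ⊢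
    have : (m : ℝ) * Real.log 2 ≤ m := mul_le_of_le_one_right (by positivity) hlog2
    linarith
  have h4 : (4 : ℝ) ^ h = Real.exp (2 * Real.log 2 * h) := by
    rw [mul_comm, Real.exp_nat_mul, show 2 * Real.log 2 = Real.log 4 by
      rw [show (4 : ℝ) = 2 ^ 2 by norm_num, Real.log_pow]; norm_num, Real.exp_log (by norm_num)]
  calc _ = (((h : ℝ) + 1) * (2 * Real.sqrt h)) *
        (Real.exp (2 * η * h) * (2 * Real.sqrt h) ^ m) := by ring
    _ ≤ (ε * Real.exp (η * h)) * (Real.exp (2 * η * h) * Real.exp ((κ + η) * h)) := by gcongr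
    _ = ε * Real.exp ((κ + 4 * η) * h) := by
        rw [mul_assoc, ← Real.exp_add, ← Real.exp_add]; congr 2; ring
    _ ≤ _ := by rw [h4]; gcongr

/-! ### The sum over all overlaps. -/

theorem eventually_sum_prod_hypCollision_le {C : ℝ} (hC : (2 * Real.log 2)⁻¹ < C) {ε : ℝ}
    (hε : 0 < ε) :
    ∀ᶠ h : ℕ in Filter.atTop, ∀ m : ℕ, C * (m : ℝ) * Real.log m ≤ (2 * h : ℕ) →
      ∀ t : Fin m → ℕ, (∀ i, (t i : ℝ) ≤ 0.49 * h) →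
        ∑ a ∈ Finset.range (h + 1), (h.choose a : ℝ) ^ 2 *
          ∏ i, ((hypCollision a (h - a) (t i) : ℝ) * ((2 * h).choose (2 * t i) : ℝ)) ≤
        (1 + ε) * ((2 * h).choose h : ℝ) * ∏ i, (h.choose (t i) : ℝ) ^ 4 := by
  have hl2 : 0 < Real.log 2 := Real.log_pos (by norm_num)
  have hC0 : 0 < C := lt_trans (by positivity) hC
  have hC2 : C⁻¹ < 2 * Real.log 2 := by
    rw [inv_lt_comm₀ hC0 (by positivity)]; exact hC
  obtain ⟨κ, hκ1, hκ2⟩ := exists_between hC2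
  set η := (2 * Real.log 2 - κ) / 4 with hη
  have hη0 : 0 < η := by rw [hη]; linarith
  obtain ⟨δ, hδ0, hδ⟩ := choose_le_exp_of_le hη0
  set K := 1 / δ ^ 2 + 1 + 1 / δ ^ 6 with hK
  have hK0 : 0 < K := by positivity
  have hε2 : 0 < ε / 2 := by positivity
  have hlε : 0 < Real.log (1 + ε / 2) := Real.log_pos (by linarith)
  -- Chosen so that m ≤ 2γh gives θ = 4Km/h ≤ 8Kγ, hence θ ≤ 1 for Jensen and θ/4 + 2θ ≤ 3θ ≤
  -- log(1+ε/2) for the final central bound.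
  set γ := min 1 (Real.log (1 + ε / 2) / 3) / (8 * K) with hγ
  have hmin0 : 0 < min 1 (Real.log (1 + ε / 2) / 3) := lt_min one_pos (by positivity)
  have hγ0 : 0 < γ := by positivity
  filter_upwards [Filter.eventually_ge_atTop 1,
    tendsto_two_mul_atTop.eventually (eventually_mul_log_le hC0 hκ1),
    tendsto_two_mul_atTop.eventually (eventually_le_mul κ hγ0),
    eventually_outer_le hη0 (κ := κ) (by rw [hη]; linarith) hε2] with h hh1 hA hB hO m hm t ht
  have hmκ := hA m hm
  have hmγ := hB m hmκ
  have hout := hO m hmκ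
  have hh0 : (0 : ℝ) < h := by exact_mod_cast hh1
  push_cast at hmγ
  set θ := 4 * K * m / h with hθ
  have hθ0 : 0 ≤ θ := by positivity
  have hθm : θ ≤ min 1 (Real.log (1 + ε / 2) / 3) := by
    rw [hθ, div_le_iff₀ hh0]
    calc 4 * K * (m : ℝ) ≤ 4 * K * (γ * (2 * h)) := by gcongr
      _ = γ * (8 * K) * h := by ring
      _ = _ := by rw [hγ, div_mul_cancel₀ _ (by positivity)]
  have hθ1 : θ ≤ 1 := hθm.trans (min_le_left _ _)
  have hθ2 : θ ≤ Real.log (1 + ε / 2) / 3 := hθm.trans (min_le_right _ _)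
  set P : ℝ := ∏ i, (h.choose (t i) : ℝ) ^ 4 with hP
  have hP0 : 0 ≤ P := Finset.prod_nonneg fun i _ => by positivity
  set M : ℝ := ((2 * h).choose h : ℝ) with hM
  have hs : 0 < 2 * Real.sqrt h := by
    have := Real.sqrt_pos.2 hh0
    positivity
  -- Each term is bounded by the sum of its central and outer bounds, so the range of a never has to
  -- be split.
  have hterm : ∀ a ∈ Finset.range (h + 1), (h.choose a : ℝ) ^ 2 *
      ∏ i, ((hypCollision a (h - a) (t i) : ℝ) * ((2 * h).choose (2 * t i) : ℝ)) ≤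
      P * (Real.exp (θ / 4) * ((h.choose a : ℝ) ^ 2 *
        Real.exp (θ * ((2 * (a : ℝ) - h) ^ 2 / (4 * h)))) +
        Real.exp (2 * η * h) * (2 * Real.sqrt h) ^ m) := by
    intro a ha
    have ha' : a ≤ h := Nat.lt_succ_iff.1 (Finset.mem_range.1 ha)
    obtain ⟨b, rfl⟩ := Nat.exists_eq_add_of_le ha'
    rw [Nat.add_sub_cancel_left]
    have htn : ∀ i, t i ≤ a + b := fun i => by
      have h1 := ht i
      norm_num at h1
      have : (t i : ℝ) ≤ (a + b : ℕ) := by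
        push_cast; linarith [show (0 : ℝ) ≤ (a : ℝ) + b by positivity]
      exact_mod_cast this
    by_cases hab : δ * (a + b : ℕ) ≤ a ∧ δ * (a + b : ℕ) ≤ b
    · have hi : ∀ i, (hypCollision a b (t i) : ℝ) *
          ((2 * (a + b)).choose (2 * t i) : ℝ) ≤ ((a + b).choose (t i) : ℝ) ^ 4 *
            Real.exp (K * (((a : ℝ) - b) ^ 2 / (a + b) ^ 2 + 1 / (a + b))) := by
        intro i
        have h1 := hypCollision_mul_choose_le hδ0 (a := a) (b := b) (t := t i)
          (by exact_mod_cast hab.1) (by exact_mod_cast hab.2) (by exact_mod_cast ht i)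
        refine h1.trans (mul_le_mul_of_nonneg_left ?_ (by positivity))
        rw [add_comm]
        exact Real.add_one_le_exp _
      have hprod := prod_le_prod_mul_pow (fun i => by positivity) hi
      rw [← Real.exp_nat_mul] at hprod
      -- With a+b = h, (a-b)²/h² is 4/h times (2a-h)²/(4h); this is where θ = 4Km/h comes from, and
      -- mK/h = θ/4.
      have e : (m : ℝ) * (K * (((a : ℝ) - b) ^ 2 / (a + b) ^ 2 + 1 / (a + b))) =
          θ / 4 + θ * ((2 * (a : ℝ) - (a + b : ℕ)) ^ 2 / (4 * (a + b : ℕ))) := by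
        rw [hθ]; push_cast at hh0 ⊢; field_simp; ring
      rw [e, Real.exp_add] at hprod
      calc _ ≤ ((a + b).choose a : ℝ) ^ 2 * (P * (Real.exp (θ / 4) *
            Real.exp (θ * ((2 * (a : ℝ) - (a + b : ℕ)) ^ 2 / (4 * (a + b : ℕ)))))) := by
            gcongr
        _ = P * (Real.exp (θ / 4) * (((a + b).choose a : ℝ) ^ 2 *
            Real.exp (θ * ((2 * (a : ℝ) - (a + b : ℕ)) ^ 2 / (4 * (a + b : ℕ)))))) := by ring
        _ ≤ _ := by
            refine mul_le_mul_of_nonneg_left (le_add_of_nonneg_right ?_) hP0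
            positivity
    · have hc : ((a + b).choose a : ℝ) ≤ Real.exp (η * (a + b : ℕ)) := by
        by_cases h1 : δ * (a + b : ℕ) ≤ a
        · have h2 : (b : ℝ) ≤ δ * (a + b : ℕ) := by
            by_contra! h2; exact hab ⟨h1, h2.le⟩
          rw [Nat.choose_symm_add]
          exact hδ _ _ h2
        · exact hδ _ _ (not_le.1 h1).le
      have hi : ∀ i, (hypCollision a b (t i) : ℝ) *
          ((2 * (a + b)).choose (2 * t i) : ℝ) ≤ ((a + b).choose (t i) : ℝ) ^ 4 *
            (2 * Real.sqrt (a + b : ℕ)) := fun i =>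
        hypCollision_mul_choose_le_sqrt (htn i) hh1
      have hprod := prod_le_prod_mul_pow (fun i => by positivity) hi
      calc _ ≤ Real.exp (η * (a + b : ℕ)) ^ 2 * (P * (2 * Real.sqrt (a + b : ℕ)) ^ m) := by
            gcongr
        _ = P * (Real.exp (2 * η * (a + b : ℕ)) * (2 * Real.sqrt (a + b : ℕ)) ^ m) := by
            rw [← Real.exp_nat_mul]; push_cast
            rw [show 2 * (η * ((a : ℝ) + b)) = 2 * η * (a + b) by ring]; ring
        _ ≤ _ := by
            refine mul_le_mul_of_nonneg_left (le_add_of_nonneg_left ?_) hP0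
            positivity
  refine (Finset.sum_le_sum hterm).trans ?_
  rw [← Finset.mul_sum, Finset.sum_add_distrib, ← Finset.mul_sum, Finset.sum_const,
    Finset.card_range, nsmul_eq_mul]
  have hcen : Real.exp (θ / 4) * ∑ a ∈ Finset.range (h + 1), (h.choose a : ℝ) ^ 2 *
      Real.exp (θ * ((2 * (a : ℝ) - h) ^ 2 / (4 * h))) ≤ (1 + ε / 2) * M := by
    calc _ ≤ Real.exp (θ / 4) * (M * Real.exp (2 * θ)) := by
          gcongr; exact sum_choose_sq_mul_exp_le hh1 hθ0 hθ1
      _ = Real.exp (θ / 4 + 2 * θ) * M := by rw [Real.exp_add]; ring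
      _ ≤ Real.exp (Real.log (1 + ε / 2)) * M := by
          have : θ / 4 + 2 * θ ≤ Real.log (1 + ε / 2) := by linarith
          gcongr
      _ = _ := by rw [Real.exp_log (by positivity)]
  have hout2 : ((h + 1 : ℕ) : ℝ) * (Real.exp (2 * η * h) * (2 * Real.sqrt h) ^ m) ≤
      ε / 2 * M := by
    refine le_of_mul_le_mul_right ?_ hs
    have h4 := mul_le_mul_of_nonneg_left (four_pow_le_choose_mul_sqrt hh1) hε2.le
    push_cast
    linarith
  calc _ ≤ P * ((1 + ε / 2) * M + ε / 2 * M) := by gcongr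
    _ = _ := by ring

/-! ### Counting rows split evenly by one or two halves. -/

lemma sum_powerset_union {α R : Type*} [DecidableEq α] [CommSemiring R] {A B : Finset α}
    (hAB : Disjoint A B) (F G : Finset α → R) :
    ∑ T ∈ (A ∪ B).powerset, F (T ∩ A) * G (T ∩ B) =
      (∑ T ∈ A.powerset, F T) * ∑ T ∈ B.powerset, G T := by
  rw [Finset.sum_mul_sum, ← Finset.sum_product']
  refine Finset.sum_nbij' (fun T => (T ∩ A, T ∩ B)) (fun X => X.1 ∪ X.2) ?_ ?_ ?_ ?_ ?_
  · intro T _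
    simp [Finset.inter_subset_right]
  · rintro ⟨X, Y⟩ h
    simp only [Finset.mem_product, Finset.mem_powerset] at h ⊢
    exact Finset.union_subset_union h.1 h.2
  · intro T hT
    simp only
    rw [← Finset.inter_union_distrib_left, Finset.inter_eq_left.2 (Finset.mem_powerset.1 hT)]
  · rintro ⟨X, Y⟩ h
    simp only [Finset.mem_product, Finset.mem_powerset] at h
    have h1 : Y ∩ A = ∅ := Finset.disjoint_iff_inter_eq_empty.1
      ((hAB.mono_right h.2).symm)
    have h2 : X ∩ B = ∅ := Finset.disjoint_iff_inter_eq_empty.1 (hAB.mono_left h.1)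
    simp [Finset.union_inter_distrib_right, h1, h2, Finset.inter_eq_left.2 h.1,
      Finset.inter_eq_left.2 h.2]
  · intro T _; rfl

lemma sum_powerset_card_eq {α : Type*} (A : Finset α) (s : ℕ) :
    ∑ T ∈ A.powerset, (if T.card = s then (1 : ℝ) else 0) = (A.card.choose s : ℝ) := by
  rw [Finset.sum_boole, ← Finset.powersetCard_eq_filter, Finset.card_powersetCard]

section Counting

variable {α : Type*} [Fintype α] [DecidableEq α]

lemma sum_inter_card_inter_compl_card (U : Finset α) (s r : ℕ) :
    ∑ T : Finset α, (if (T ∩ U).card = s then (1 : ℝ) else 0) *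
      (if (T ∩ Uᶜ).card = r then 1 else 0) = (U.card.choose s : ℝ) * (Uᶜ.card.choose r : ℝ) := by
  have h := sum_powerset_union (disjoint_compl_right (a := U))
    (fun T => if T.card = s then (1 : ℝ) else 0) (fun T => if T.card = r then (1 : ℝ) else 0)
  rw [sum_powerset_card_eq, sum_powerset_card_eq, Finset.union_compl, Finset.powerset_univ] at h
  exact h

lemma card_inter_add_card_inter_compl (T U : Finset α) :
    (T ∩ U).card + (T ∩ Uᶜ).card = T.card := by
  rw [← Finset.card_union_of_disjoint, ← Finset.inter_union_distrib_left, Finset.union_compl,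
    Finset.inter_univ]
  exact disjoint_compl_right.mono Finset.inter_subset_right Finset.inter_subset_right

/-- Summation over all `h`-subsets `V` according to the size of the intersection with a fixed
`h`-subset `U`. -/
lemma sum_powersetCard_inter {h : ℕ} {U : Finset α} (hU : U.card = h)
    (hUc : Uᶜ.card = h) (g : ℕ → ℝ) :
    ∑ V ∈ Finset.powersetCard h Finset.univ, g (V ∩ U).card =
      ∑ a ∈ Finset.range (h + 1), (h.choose a : ℝ) ^ 2 * g a := by
  rw [Finset.powersetCard_eq_filter, Finset.powerset_univ, Finset.sum_filter]
  have key : ∀ V : Finset α, (if V.card = h then g (V ∩ U).card else 0) =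
      ∑ a ∈ Finset.range (h + 1), g a * ((if (V ∩ U).card = a then (1 : ℝ) else 0) *
        (if (V ∩ Uᶜ).card = h - a then 1 else 0)) := by
    intro V
    have hle : (V ∩ U).card ≤ h := hU ▸ Finset.card_le_card Finset.inter_subset_right
    have hc := card_inter_add_card_inter_compl V U
    rw [Finset.sum_eq_single (V ∩ U).card]
    · have : V.card = h ↔ (V ∩ Uᶜ).card = h - (V ∩ U).card := by omega
      simp [this]
    · intro a _ ha; simp [Ne.symm ha]
    · intro hn; exact absurd (Finset.mem_range.2 (Nat.lt_succ_of_le hle)) hn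
  simp_rw [key]
  rw [Finset.sum_comm]
  refine Finset.sum_congr rfl fun a ha => ?_
  have ha' : a ≤ h := Nat.lt_succ_iff.1 (Finset.mem_range.1 ha)
  rw [← Finset.mul_sum, sum_inter_card_inter_compl_card, hU, hUc, Nat.choose_symm ha']
  ring

lemma sum_powersetCard_balanced {h t : ℕ} {U : Finset α} (hU : U.card = h) (hUc : Uᶜ.card = h) :
    ∑ T ∈ Finset.powersetCard (2 * t) Finset.univ,
      (if 2 * (T ∩ U).card = T.card then (1 : ℝ) else 0) = (h.choose t : ℝ) ^ 2 := by
  rw [Finset.powersetCard_eq_filter, Finset.powerset_univ, Finset.sum_filter]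
  have key : ∀ T : Finset α, (if T.card = 2 * t then
      (if 2 * (T ∩ U).card = T.card then (1 : ℝ) else 0) else 0) =
      (if (T ∩ U).card = t then (1 : ℝ) else 0) * (if (T ∩ Uᶜ).card = t then 1 else 0) := by
    intro T
    have hc := card_inter_add_card_inter_compl T U
    by_cases h1 : (T ∩ U).card = t <;> by_cases h2 : (T ∩ Uᶜ).card = t <;>
      simp only [h1, h2, if_true, if_false, mul_one, mul_zero] <;> split_ifs <;> first | rfl | omega
  simp_rw [key]
  rw [sum_inter_card_inter_compl_card, hU, hUc, sq]

/-- U and V cut the columns into four cells of sizes a, h-a, h-a, a. A row split evenly by both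
meets them in s, t-s, t-s, s elements, so the count for given s is a perfect square. -/
lemma sum_powersetCard_balanced_balanced {h t : ℕ} {U V : Finset α} (hU : U.card = h)
    (hUc : Uᶜ.card = h) (hV : V.card = h) :
    ∑ T ∈ Finset.powersetCard (2 * t) Finset.univ,
      (if 2 * (T ∩ U).card = T.card then (1 : ℝ) else 0) *
        (if 2 * (T ∩ V).card = T.card then (1 : ℝ) else 0) =
      (hypCollision (V ∩ U).card (h - (V ∩ U).card) t : ℝ) := by
  rw [Finset.powersetCard_eq_filter, Finset.powerset_univ, Finset.sum_filter]
  set x : ℕ → ℕ → Finset α → ℝ := fun s r T =>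
    (if (T ∩ V).card = s then (1 : ℝ) else 0) * (if (T ∩ Vᶜ).card = r then 1 else 0) with hx
  have key : ∀ T : Finset α, (if T.card = 2 * t then
      (if 2 * (T ∩ U).card = T.card then (1 : ℝ) else 0) *
        (if 2 * (T ∩ V).card = T.card then (1 : ℝ) else 0) else 0) =
      ∑ s ∈ Finset.range (t + 1), x s (t - s) (T ∩ U) * x (t - s) s (T ∩ Uᶜ) := by
    intro T
    have c1 := card_inter_add_card_inter_compl T U
    have c2 := card_inter_add_card_inter_compl (T ∩ U) V
    have c3 := card_inter_add_card_inter_compl (T ∩ Uᶜ) V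
    have c4 : (T ∩ U ∩ V).card + (T ∩ Uᶜ ∩ V).card = (T ∩ V).card := by
      rw [← card_inter_add_card_inter_compl (T ∩ V) U, Finset.inter_right_comm T U,
        Finset.inter_right_comm T Uᶜ]
    by_cases hall : T.card = 2 * t ∧ 2 * (T ∩ U).card = T.card ∧ 2 * (T ∩ V).card = T.card
    · rw [if_pos hall.1, if_pos hall.2.1, if_pos hall.2.2, Finset.sum_eq_single (T ∩ U ∩ V).card]
      · simp only [hx]
        rw [show (T ∩ U ∩ Vᶜ).card = t - (T ∩ U ∩ V).card by omega,
          show (T ∩ Uᶜ ∩ V).card = t - (T ∩ U ∩ V).card by omega,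
          show (T ∩ Uᶜ ∩ Vᶜ).card = (T ∩ U ∩ V).card by omega]
        simp only [if_true, mul_one]
      · intro s _ hs
        simp only [hx, if_neg (Ne.symm hs), zero_mul]
      · intro hn
        exact absurd (Finset.mem_range.2 (by omega)) hn
    · trans (0 : ℝ)
      · by_cases h1 : T.card = 2 * t
        · rw [if_pos h1]
          by_cases h2 : 2 * (T ∩ U).card = T.card
          · rw [if_neg (fun h3 => hall ⟨h1, h2, h3⟩), mul_zero]
          · rw [if_neg h2, zero_mul]
        · rw [if_neg h1]
      · refine (Finset.sum_eq_zero fun s hs => ?_).symm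
        have hs' : s ≤ t := Nat.lt_succ_iff.1 (Finset.mem_range.1 hs)
        simp only [hx]
        by_cases g1 : (T ∩ U ∩ V).card = s
        · by_cases g2 : (T ∩ U ∩ Vᶜ).card = t - s
          · by_cases g3 : (T ∩ Uᶜ ∩ V).card = t - s
            · by_cases g4 : (T ∩ Uᶜ ∩ Vᶜ).card = s
              · exact absurd ⟨by omega, by omega, by omega⟩ hall
              · simp only [if_neg g4, mul_zero]
            · simp only [if_neg g3, mul_zero, zero_mul]
          · simp only [if_neg g2, mul_zero, zero_mul]
        · simp only [if_neg g1, zero_mul]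
  simp_rw [key]
  rw [Finset.sum_comm, hypCollision]
  push_cast
  refine Finset.sum_congr rfl fun s _ => ?_
  have hsplit := sum_powerset_union (disjoint_compl_right (a := U)) (x s (t - s)) (x (t - s) s)
  rw [Finset.union_compl, Finset.powerset_univ] at hsplit
  rw [hsplit]
  have hin : ∀ (W : Finset α) (s r : ℕ), ∑ T ∈ W.powerset, x s r T =
      ((W ∩ V).card.choose s : ℝ) * ((W ∩ Vᶜ).card.choose r : ℝ) := by
    intro W s r
    have hd : Disjoint (W ∩ V) (W ∩ Vᶜ) :=
      disjoint_compl_right.mono Finset.inter_subset_right Finset.inter_subset_right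
    have h2 := sum_powerset_union hd
      (fun T => if T.card = s then (1 : ℝ) else 0) (fun T => if T.card = r then (1 : ℝ) else 0)
    rw [sum_powerset_card_eq, sum_powerset_card_eq, ← Finset.inter_union_distrib_left,
      Finset.union_compl, Finset.inter_univ] at h2
    rw [← h2]
    refine Finset.sum_congr rfl fun T hT => ?_
    rw [← Finset.inter_assoc, ← Finset.inter_assoc,
      Finset.inter_eq_left.2 (Finset.mem_powerset.1 hT)]
  rw [hin, hin]
  have d1 := card_inter_add_card_inter_compl U V
  have d2 := card_inter_add_card_inter_compl Uᶜ V
  have d3 := card_inter_add_card_inter_compl V U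
  rw [Finset.inter_comm V U, Finset.inter_comm V Uᶜ] at d3
  rw [Finset.inter_comm V U, show (U ∩ Vᶜ).card = h - (U ∩ V).card by omega,
    show (Uᶜ ∩ V).card = h - (U ∩ V).card by omega, show (Uᶜ ∩ Vᶜ).card = (U ∩ V).card by omega]
  ring

end Counting

/-! ### First and second moments of the number of splitting halves. -/

section Moments

variable {n m : ℕ}

/-- The families of rows (as subsets of the columns) with prescribed weights. -/
def rowFamilies (n : ℕ) (w : Fin m → ℕ) : Finset (Fin m → Finset (Fin n)) :=
  Fintype.piFinset fun i => Finset.powersetCard (w i) Finset.univ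

/-- The `0/1` matrix with given row supports. -/
def supportMatrix (M : Fin m → Finset (Fin n)) : Matrix (Fin m) (Fin n) ℤ :=
  fun i j => if j ∈ M i then 1 else 0

/-- The number of half-size subsets splitting every row evenly. -/
noncomputable def splitCount (h : ℕ) (M : Fin m → Finset (Fin n)) : ℝ :=
  ∑ U ∈ Finset.powersetCard h (Finset.univ : Finset (Fin n)),
    ∏ i, if 2 * (M i ∩ U).card = (M i).card then (1 : ℝ) else 0

lemma card_rowFamilies (w : Fin m → ℕ) :
    ((rowFamilies n w).card : ℝ) = ∏ i, (n.choose (w i) : ℝ) := by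
  simp [rowFamilies, Fintype.card_piFinset]

lemma card_compl_of_card_eq {h : ℕ} {U : Finset (Fin (2 * h))} (hU : U.card = h) :
    Uᶜ.card = h := by
  rw [Finset.card_compl, hU, Fintype.card_fin]; omega

lemma sum_splitCount (h : ℕ) (t : Fin m → ℕ) :
    ∑ M ∈ rowFamilies (2 * h) (fun i => 2 * t i), splitCount h M =
      ((2 * h).choose h : ℝ) * ∏ i, (h.choose (t i) : ℝ) ^ 2 := by
  simp only [splitCount]
  rw [Finset.sum_comm]
  have : ∀ U ∈ Finset.powersetCard h (Finset.univ : Finset (Fin (2 * h))),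
      ∑ M ∈ rowFamilies (2 * h) (fun i => 2 * t i),
        ∏ i, (if 2 * (M i ∩ U).card = (M i).card then (1 : ℝ) else 0) =
      ∏ i, (h.choose (t i) : ℝ) ^ 2 := by
    intro U hU
    have hU' := (Finset.mem_powersetCard.1 hU).2
    rw [rowFamilies, ← Finset.prod_univ_sum (fun i => Finset.powersetCard (2 * t i) Finset.univ)
      (fun _ T => if 2 * (T ∩ U).card = T.card then (1 : ℝ) else 0)]
    exact Finset.prod_congr rfl fun i _ =>
      sum_powersetCard_balanced hU' (card_compl_of_card_eq hU')
  rw [Finset.sum_congr rfl this, Finset.sum_const, Finset.card_powersetCard, Finset.card_univ,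
    Fintype.card_fin, nsmul_eq_mul]

lemma sum_splitCount_sq (h : ℕ) (t : Fin m → ℕ) :
    ∑ M ∈ rowFamilies (2 * h) (fun i => 2 * t i), splitCount h M ^ 2 =
      ((2 * h).choose h : ℝ) * ∑ a ∈ Finset.range (h + 1), (h.choose a : ℝ) ^ 2 *
        ∏ i, (hypCollision a (h - a) (t i) : ℝ) := by
  simp only [splitCount, sq (Finset.sum _ _), Finset.sum_mul_sum, ← Finset.prod_mul_distrib]
  rw [Finset.sum_comm]
  have : ∀ U ∈ Finset.powersetCard h (Finset.univ : Finset (Fin (2 * h))),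
      ∑ M ∈ rowFamilies (2 * h) (fun i => 2 * t i),
        ∑ V ∈ Finset.powersetCard h (Finset.univ : Finset (Fin (2 * h))),
        ∏ i, ((if 2 * (M i ∩ U).card = (M i).card then (1 : ℝ) else 0) *
          (if 2 * (M i ∩ V).card = (M i).card then (1 : ℝ) else 0)) =
      ∑ a ∈ Finset.range (h + 1), (h.choose a : ℝ) ^ 2 *
        ∏ i, (hypCollision a (h - a) (t i) : ℝ) := by
    intro U hU
    have hU' := (Finset.mem_powersetCard.1 hU).2
    rw [Finset.sum_comm, ← sum_powersetCard_inter hU' (card_compl_of_card_eq hU')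
      (fun a => ∏ i, (hypCollision a (h - a) (t i) : ℝ))]
    refine Finset.sum_congr rfl fun V hV => ?_
    have hV' := (Finset.mem_powersetCard.1 hV).2
    rw [rowFamilies, ← Finset.prod_univ_sum (fun i => Finset.powersetCard (2 * t i) Finset.univ)
      (fun _ T => (if 2 * (T ∩ U).card = T.card then (1 : ℝ) else 0) *
        (if 2 * (T ∩ V).card = T.card then (1 : ℝ) else 0))]
    exact Finset.prod_congr rfl fun i _ =>
      sum_powersetCard_balanced_balanced hU' (card_compl_of_card_eq hU') hV'
  rw [Finset.sum_congr rfl this, Finset.sum_const, Finset.card_powersetCard, Finset.card_univ,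
    Fintype.card_fin, nsmul_eq_mul]

lemma sum_signVec_eq (u : Fin n → ℤˣ) (T : Finset (Fin n)) :
    ∑ j ∈ T, signVec u j =
      2 * ((T ∩ Finset.univ.filter fun j => u j = 1).card : ℤ) - T.card := by
  have h1 : ∀ j, signVec u j = 2 * (if u j = 1 then 1 else 0) - 1 := by
    intro j
    rcases Int.units_eq_one_or (u j) with h | h <;> simp [signVec, h]
  simp_rw [h1]
  rw [Finset.sum_sub_distrib, ← Finset.mul_sum, Finset.sum_boole]
  have h2 : T.filter (fun j => u j = 1) = T ∩ Finset.univ.filter fun j => u j = 1 := by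
    ext j; simp
  rw [h2]
  simp

lemma mulVec_supportMatrix (M : Fin m → Finset (Fin n)) (u : Fin n → ℤˣ) (i : Fin m) :
    (supportMatrix M).mulVec (signVec u) i =
      2 * ((M i ∩ Finset.univ.filter fun j => u j = 1).card : ℤ) - (M i).card := by
  rw [← sum_signVec_eq]
  simp [Matrix.mulVec, dotProduct, supportMatrix, ite_mul]

/-- A sign vector corresponds to U = {j : u_j = 1}. Balance means |U| = h, and the i-th entry of the
product is 2|M_i ∩ U| - |M_i|. -/
lemma balancedCount_supportMatrix (h : ℕ) (M : Fin m → Finset (Fin (2 * h))) :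
    (balancedCount 0 (supportMatrix M) : ℝ) = splitCount h M := by
  classical
  have e1 : splitCount h M = (((Finset.powersetCard h Finset.univ).filter
      fun U : Finset (Fin (2 * h)) => ∀ i, 2 * (M i ∩ U).card = (M i).card).card : ℝ) := by
    rw [splitCount, ← Finset.sum_boole]
    refine Finset.sum_congr rfl fun U _ => ?_
    rw [Finset.prod_ite_zero]; simp
  rw [e1, balancedCount]
  norm_cast
  have hbal : ∀ u : Fin (2 * h) → ℤˣ, IsBalanced u ↔
      (Finset.univ.filter fun j => u j = 1).card = h := by
    intro u
    rw [IsBalanced, sum_signVec_eq, Finset.univ_inter, Finset.card_univ, Fintype.card_fin]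
    push_cast; omega
  have hnorm : ∀ u : Fin (2 * h) → ℤˣ, ‖(supportMatrix M).mulVec (signVec u)‖ ≤ 0 ↔
      ∀ i, 2 * (M i ∩ Finset.univ.filter fun j => u j = 1).card = (M i).card := by
    intro u
    rw [norm_le_zero_iff, funext_iff]
    refine forall_congr' fun i => ?_
    rw [mulVec_supportMatrix, Pi.zero_apply]
    omega
  refine Finset.card_nbij' (fun u => Finset.univ.filter fun j => u j = 1)
    (fun U j => if j ∈ U then 1 else -1) ?_ ?_ ?_ ?_
  · intro u hu
    simp only [Finset.coe_filter, Finset.mem_univ, true_and, Set.mem_ofPred_eq, hbal, hnorm] at hu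
    simp only [Finset.coe_filter, Finset.mem_powersetCard, Finset.subset_univ, true_and,
      Set.mem_ofPred_eq]
    exact hu
  · intro U hU
    simp only [Finset.coe_filter, Finset.mem_powersetCard, Finset.subset_univ, true_and,
      Set.mem_ofPred_eq] at hU
    have hUeq : (Finset.univ.filter fun j => (if j ∈ U then (1 : ℤˣ) else -1) = 1) = U := by
      ext j; by_cases hj : j ∈ U <;> simp [hj]
    simp only [Finset.coe_filter, Finset.mem_univ, true_and, Set.mem_ofPred_eq, hbal, hnorm, hUeq]
    exact hU
  · intro u _
    ext j
    rcases Int.units_eq_one_or (u j) with h | h <;> simp [h]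
  · intro U _
    ext j; by_cases hj : j ∈ U <;> simp [hj]

end Moments

/-! ### The Bernoulli ensemble conditioned on its row weights. -/

lemma supportMatrix_injective {m n : ℕ} :
    Function.Injective (supportMatrix : (Fin m → Finset (Fin n)) → Matrix (Fin m) (Fin n) ℤ) := by
  intro M M' h
  ext i j
  have := congrFun (congrFun h i) j
  by_cases h1 : j ∈ M i <;> by_cases h2 : j ∈ M' i <;> simp_all [supportMatrix]

lemma rowWeights_supportMatrix {m n : ℕ} (M : Fin m → Finset (Fin n)) (i : Fin m) :
    rowWeights (supportMatrix M) i = (M i).card := by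
  simp [rowWeights, supportMatrix]

namespace IsBernoulliEnsemble

variable {Ω : Type*} [MeasurableSpace Ω] {μ : Measure Ω} {m n : ℕ} {p : ℝ}
  {A : Ω → Matrix (Fin m) (Fin n) ℤ}

lemma measure_entry_eq (hA : IsBernoulliEnsemble μ p A) (i : Fin m) (j : Fin n) (s : Set ℤ) :
    μ ((fun ω => A ω i j) ⁻¹' s) =
      ENNReal.ofReal p * s.indicator 1 1 + ENNReal.ofReal (1 - p) * s.indicator 1 0 := by
  rw [← Measure.map_apply (hA.measurable_entry i j) (MeasurableSet.of_discrete),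
    hA.law_entry i j]
  simp

lemma ae_exists_supportMatrix (hA : IsBernoulliEnsemble μ p A) :
    ∀ᵐ ω ∂μ, ∃ M, A ω = supportMatrix M := by
  have h : ∀ i j, ∀ᵐ ω ∂μ, A ω i j = 1 ∨ A ω i j = 0 := by
    intro i j
    have := hA.measure_entry_eq i j {x | ¬(x = 1 ∨ x = 0)}
    simpa [ae_iff] using this
  have h2 : ∀ᵐ ω ∂μ, ∀ i j, A ω i j = 1 ∨ A ω i j = 0 :=
    ae_all_iff.2 fun i => ae_all_iff.2 fun j => h i j
  filter_upwards [h2] with ω hω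
  refine ⟨fun i => Finset.univ.filter fun j => A ω i j = 1, ?_⟩
  ext i j
  rcases hω i j with h | h <;> simp [supportMatrix, h]

lemma measurableSet_eq (hA : IsBernoulliEnsemble μ p A) (B : Matrix (Fin m) (Fin n) ℤ) :
    MeasurableSet {ω | A ω = B} := by
  have : {ω | A ω = B} = ⋂ i, ⋂ j, (fun ω => A ω i j) ⁻¹' {B i j} := by
    ext ω; simp [← Matrix.ext_iff]
  rw [this]
  exact MeasurableSet.iInter fun i => MeasurableSet.iInter fun j =>
    hA.measurable_entry i j (measurableSet_singleton _)

lemma measurableSet_rowWeightEvent (hA : IsBernoulliEnsemble μ p A) (w : Fin m → ℕ) :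
    MeasurableSet (rowWeightEvent A w) := by
  have : rowWeightEvent A w = ⋂ i, (fun ω => ∑ j, A ω i j) ⁻¹' {(w i : ℤ)} := by
    ext ω; simp [rowWeightEvent, rowWeights, funext_iff]
  rw [this]
  exact MeasurableSet.iInter fun i =>
    (Finset.measurable_fun_sum _ fun j _ => hA.measurable_entry i j) (measurableSet_singleton _)

lemma measure_eq_supportMatrix (hA : IsBernoulliEnsemble μ p A) {w : Fin m → ℕ}
    {M : Fin m → Finset (Fin n)} (hM : M ∈ rowFamilies n w) :
    μ {ω | A ω = supportMatrix M} =
      ∏ i, (ENNReal.ofReal p ^ w i * ENNReal.ofReal (1 - p) ^ (n - w i)) := by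
  have h1 : {ω | A ω = supportMatrix M} = ⋂ ij ∈ (Finset.univ : Finset (Fin m × Fin n)),
      (fun ω => A ω ij.1 ij.2) ⁻¹' {supportMatrix M ij.1 ij.2} := by
    ext ω; simp [← Matrix.ext_iff]
  rw [h1, hA.indep.measure_inter_preimage_eq_mul _ fun _ _ => measurableSet_singleton _,
    ← Finset.univ_product_univ, Finset.prod_product]
  refine Finset.prod_congr rfl fun i _ => ?_
  have hc : (M i).card = w i :=
    (Finset.mem_powersetCard.1 (Fintype.mem_piFinset.1 hM i)).2
  have h2 : ∀ j, μ ((fun ω => A ω i j) ⁻¹' {supportMatrix M i j}) =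
      if j ∈ M i then ENNReal.ofReal p else ENNReal.ofReal (1 - p) := by
    intro j
    rw [hA.measure_entry_eq]
    by_cases hj : j ∈ M i <;> simp [supportMatrix, hj]
  simp_rw [h2]
  rw [Finset.prod_ite, Finset.prod_const, Finset.prod_const]
  have h3 : (Finset.univ.filter fun j => j ∈ M i) = M i := by ext; simp
  have h4 : (Finset.univ.filter fun j => j ∉ M i) = (M i)ᶜ := by ext; simp
  rw [h3, h4, Finset.card_compl, hc, Fintype.card_fin]

/-- All 0/1 matrices with row weights w are equally likely, with a probability depending only on w
and p, and almost every outcome is a 0/1 matrix. -/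
lemma setIntegral_rowWeightEvent [IsProbabilityMeasure μ] (hA : IsBernoulliEnsemble μ p A)
    (w : Fin m → ℕ) (F : Matrix (Fin m) (Fin n) ℤ → ℝ) :
    ∫ ω in rowWeightEvent A w, F (A ω) ∂μ =
      (∏ i, (ENNReal.ofReal p ^ w i * ENNReal.ofReal (1 - p) ^ (n - w i))).toReal *
        ∑ M ∈ rowFamilies n w, F (supportMatrix M) := by
  classical
  rw [← integral_indicator (hA.measurableSet_rowWeightEvent w)]
  have hae : (rowWeightEvent A w).indicator (fun ω => F (A ω)) =ᵐ[μ] fun ω =>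
      ∑ M ∈ rowFamilies n w,
        ({ω | A ω = supportMatrix M} : Set Ω).indicator (fun _ => F (supportMatrix M)) ω := by
    filter_upwards [hA.ae_exists_supportMatrix] with ω ⟨M, hM⟩
    have hmem : ω ∈ rowWeightEvent A w ↔ M ∈ rowFamilies n w := by
      rw [rowWeightEvent, rowFamilies, Fintype.mem_piFinset]
      simp only [Set.mem_ofPred_eq, hM, funext_iff, rowWeights_supportMatrix,
        Finset.mem_powersetCard, Finset.subset_univ, true_and, Nat.cast_inj]
    have hin : ∀ M', ({ω | A ω = supportMatrix M'} : Set Ω).indicator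
        (fun _ => F (supportMatrix M')) ω = if M = M' then F (supportMatrix M) else 0 := by
      intro M'
      simp only [Set.indicator_apply, Set.mem_ofPred_eq, hM, supportMatrix_injective.eq_iff]
      split_ifs with h
      · rw [h]
      · rfl
    simp_rw [hin]
    rw [Finset.sum_ite_eq]
    simp only [Set.indicator_apply, hmem, hM]
  rw [integral_congr_ae hae, integral_finsetSum _ fun M _ =>
    (integrable_const _).indicator (hA.measurableSet_eq _), Finset.mul_sum]
  refine Finset.sum_congr rfl fun M hM => ?_
  rw [integral_indicator_const _ (hA.measurableSet_eq _), measureReal_def,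
    hA.measure_eq_supportMatrix hM, smul_eq_mul]

/-- Conditionally on the row weights, the matrix is uniformly distributed. -/
lemma integral_cond_rowWeightEvent [IsProbabilityMeasure μ] (hA : IsBernoulliEnsemble μ p A)
    {w : Fin m → ℕ} (hw : μ (rowWeightEvent A w) ≠ 0) (F : Matrix (Fin m) (Fin n) ℤ → ℝ) :
    ((rowFamilies n w).card : ℝ) ≠ 0 ∧
    ∫ ω, F (A ω) ∂(μ[|rowWeightEvent A w]) =
      (∑ M ∈ rowFamilies n w, F (supportMatrix M)) / ((rowFamilies n w).card : ℝ) := by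
  -- The constant function 1 gives the probability of the conditioning event; as this is nonzero, so
  -- are the common atom probability and the number of families, and the atom probability cancels in
  -- the quotient.
  have h1 := hA.setIntegral_rowWeightEvent w fun _ => 1
  have h2 := hA.setIntegral_rowWeightEvent w F
  set c := (∏ i, (ENNReal.ofReal p ^ w i * ENNReal.ofReal (1 - p) ^ (n - w i))).toReal
  simp only [setIntegral_const, smul_eq_mul, mul_one, Finset.sum_const, nsmul_eq_mul,
    measureReal_def] at h1
  have h0 : (μ (rowWeightEvent A w)).toReal ≠ 0 :=
    ENNReal.toReal_ne_zero.2 ⟨hw, measure_ne_top _ _⟩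
  rw [h1] at h0
  refine ⟨right_ne_zero_of_mul h0, ?_⟩
  rw [ProbabilityTheory.cond, integral_smul_measure, ENNReal.toReal_inv, h1, h2, smul_eq_mul]
  have hc := left_ne_zero_of_mul h0
  have hN := right_ne_zero_of_mul h0
  field_simp

end IsBernoulliEnsemble

/-! ### Conclusion. -/

theorem mainTheorem6 (C : ℝ) (hC : (2 * Real.log 2)⁻¹ < C) (ε : ℝ) (hε : 0 < ε) :
    ∃ N : ℕ, ∀ n : ℕ, N ≤ n → Even n →
      ∀ m : ℕ, C * (m : ℝ) * Real.log (m : ℝ) ≤ (n : ℝ) →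
      ∀ p : ℝ, 0 ≤ p → p ≤ 1 →
      ∀ (Ω : Type*) [MeasurableSpace Ω] (μ : Measure Ω) [IsProbabilityMeasure μ]
        (A : Ω → Matrix (Fin m) (Fin n) ℤ), IsBernoulliEnsemble μ p A →
      ∀ w : Fin m → ℕ, (∀ i, Even (w i)) → (∀ i, (w i : ℝ) < 0.49 * (n : ℝ)) →
        μ (rowWeightEvent A w) ≠ 0 →
        |(∫ ω, (balancedCount 0 (A ω) : ℝ) ^ 2 ∂(μ[|rowWeightEvent A w])) -
            (∫ ω, (balancedCount 0 (A ω) : ℝ) ∂(μ[|rowWeightEvent A w])) ^ 2| ≤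
          ε * (∫ ω, (balancedCount 0 (A ω) : ℝ) ∂(μ[|rowWeightEvent A w])) ^ 2 := by
  obtain ⟨H, hH⟩ := Filter.eventually_atTop.1 (eventually_sum_prod_hypCollision_le hC hε)
  refine ⟨2 * H, fun n hn hne m hm p _ _ Ω _ μ _ A hA w hw hwn hμ => ?_⟩
  obtain ⟨h, rfl⟩ := even_iff_exists_two_mul.1 hne
  choose t ht using fun i => even_iff_exists_two_mul.1 (hw i)
  obtain rfl : w = fun i => 2 * t i := funext ht
  have hbound := hH h (by omega) m hm t fun i => by
    have := hwn i
    push_cast at this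
    linarith
  obtain ⟨hcard, hZ2⟩ := hA.integral_cond_rowWeightEvent hμ
    fun B => (balancedCount 0 B : ℝ) ^ 2
  obtain ⟨-, hZ1⟩ := hA.integral_cond_rowWeightEvent hμ fun B => (balancedCount 0 B : ℝ)
  rw [hZ2, hZ1]
  simp only [balancedCount_supportMatrix]
  -- Cauchy-Schwarz makes the variance nonnegative, so the absolute value can be dropped and only an
  -- upper bound remains.
  have hCS := sq_sum_le_card_mul_sum_sq (s := rowFamilies (2 * h) fun i => 2 * t i)
    (f := splitCount h)
  have hup : ((rowFamilies (2 * h) fun i => 2 * t i).card : ℝ) *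
      ∑ M ∈ rowFamilies (2 * h) (fun i => 2 * t i), splitCount h M ^ 2 ≤
      (1 + ε) * (∑ M ∈ rowFamilies (2 * h) (fun i => 2 * t i), splitCount h M) ^ 2 := by
    rw [sum_splitCount_sq, sum_splitCount, card_rowFamilies]
    simp_rw [Finset.prod_mul_distrib, ← mul_assoc] at hbound
    rw [← Finset.sum_mul] at hbound
    have hM : (0 : ℝ) ≤ ((2 * h).choose h : ℝ) := by positivity
    have := mul_le_mul_of_nonneg_left hbound hM
    have e : ∏ i, (h.choose (t i) : ℝ) ^ 4 = (∏ i, (h.choose (t i) : ℝ) ^ 2) ^ 2 := by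
      rw [← Finset.prod_pow]; exact Finset.prod_congr rfl fun i _ => by ring
    rw [e] at this
    linarith
  set N : ℝ := ((rowFamilies (2 * h) fun i => 2 * t i).card : ℝ)
  set S1 := ∑ M ∈ rowFamilies (2 * h) (fun i => 2 * t i), splitCount h M
  set S2 := ∑ M ∈ rowFamilies (2 * h) (fun i => 2 * t i), splitCount h M ^ 2
  have e1 : S2 / N - (S1 / N) ^ 2 = (N * S2 - S1 ^ 2) / N ^ 2 := by field_simp
  have e2 : ε * (S1 / N) ^ 2 = ε * S1 ^ 2 / N ^ 2 := by ring
  rw [e1, e2, abs_of_nonneg (div_nonneg (sub_nonneg.2 hCS) (by positivity))]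
  gcongr
  linarith
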